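/- All matroids are finite. For a positive integer $\Delta$, an integer matrix $\mathbf{A}$ is $\Delta$-modular if every $\operatorname{rank}(\mathbf{A}) \times \operatorname{rank}(\mathbf{A})$ submatrix of $\mathbf{A}$ has determinant of absolute value at most $\Delta$, and a matroid is $\Delta$-modular if it is represented over $\mathbb{R}$ by the columns of some $\Delta$-modular integer matrix. A point (respectively, a line) of a matroid is a maximal rank-$1$ (respectively, rank-$2$) set of elements, and a line is long if it contains at least three points. Given a $\Delta$-modular matroid $M$ with rank function $r_M$ and an element $f$ of $M$, let $Z$ be the union of all long lines of $M$ through $f$; the element $f$ is critical if the number of long lines of $M$ through $f$ is greater than $r_M(Z) + 70\Delta^7$. **Proposition.** Let $r$ and $\Delta$ be positive integers, and let $M$ be a simple rank-$r$ $\Delta$-modular matroid with an $M(K_{r+1})$-restriction; that is, there is a set $X \subseteq E(M)$ such that $M|X$ is isomorphic to the graphic matroid $M(K_{r+1})$ of the complete graph on $r+1$ vertices. Then $M$ has at most $200\Delta^7$ critical points, i.e. at most $200\Delta^7$ elements of $M$ are critical. -/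

import Mathlib

open Set

/-! ### Cycle matroids of graphs and cliques -/

namespace SimpleGraph

/-- The mod-2 incidence vector of an edge; an auxiliary notion, used only to check the
augmentation axiom for forests. -/
noncomputable def edgeVec {V : Type*} : Sym2 V → V → ZMod 2 := by
  classical
  exact Sym2.lift ⟨fun u v => Pi.single u 1 + Pi.single v 1, fun u v => add_comm _ _⟩

lemma edgeVec_mk {V : Type*} [DecidableEq V] (u v : V) :
    edgeVec s(u, v) = Pi.single u 1 + Pi.single v 1 := by
  simp only [edgeVec, Sym2.lift_mk]
  congr!

lemma edgeVec_mem_span_of_reachable {V : Type*} {F : Set (Sym2 V)} {u v : V}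
    (h : (fromEdgeSet F).Reachable u v) :
    edgeVec s(u, v) ∈ Submodule.span (ZMod 2) (edgeVec '' F) := by
  classical
  obtain ⟨p⟩ := h
  induction p with
  | nil =>
    rw [edgeVec_mk, ← two_smul (ZMod 2), show (2 : ZMod 2) = 0 from rfl, zero_smul]
    exact Submodule.zero_mem _
  | @cons a b c hab p ih =>
    have h1 : edgeVec s(a, b) ∈ Submodule.span (ZMod 2) (edgeVec '' F) :=
      Submodule.subset_span ⟨_, ((fromEdgeSet_adj F).1 hab).1, rfl⟩
    have h2 : (edgeVec s(a, c) : V → ZMod 2) = edgeVec s(a, b) + edgeVec s(b, c) := by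
      simp only [edgeVec_mk]
      have : (Pi.single b (1 : ZMod 2) : V → ZMod 2) + Pi.single b 1 = 0 := by
        rw [← two_smul (ZMod 2), show (2 : ZMod 2) = 0 from rfl, zero_smul]
      calc _ = Pi.single a (1 : ZMod 2) + (Pi.single b 1 + Pi.single b 1) + Pi.single c 1 := by
            rw [this, add_zero]
        _ = _ := by abel
    rw [h2]
    exact Submodule.add_mem _ h1 ih

lemma reachable_of_edgeVec_mem_span {V : Type*} {F : Set (Sym2 V)} {u v : V}
    (h : edgeVec s(u, v) ∈ Submodule.span (ZMod 2) (edgeVec '' F)) :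
    (fromEdgeSet F).Reachable u v := by
  classical
  by_contra huv
  -- the functional that sums the coordinates over the component of `u` kills every edge vector
  let x : V → ZMod 2 := fun w => if (fromEdgeSet F).Reachable u w then 1 else 0
  have key : ∀ y ∈ Submodule.span (ZMod 2) (edgeVec '' F),
      ∃ s : Finset V, Function.support y ⊆ s ∧ ∑ w ∈ s, x w * y w = 0 := by
    intro y hy
    induction hy using Submodule.span_induction with
    | mem y hy =>
      obtain ⟨e, he, rfl⟩ := hy
      induction e with
      | h a b =>
        refine ⟨{a, b}, ?_, ?_⟩
        · intro w hw
          by_contra hw'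
          simp only [Finset.coe_insert, Finset.coe_singleton, mem_insert_iff,
            mem_singleton_iff, not_or] at hw'
          simp [edgeVec_mk, hw'.1, hw'.2] at hw
        · by_cases hab : a = b
          · subst hab
            simp [edgeVec_mk, CharTwo.add_self_eq_zero]
          · have hadj : (fromEdgeSet F).Adj a b := (fromEdgeSet_adj F).2 ⟨he, hab⟩
            have hx : x a = x b := by
              have : (fromEdgeSet F).Reachable u a ↔ (fromEdgeSet F).Reachable u b :=
                ⟨fun h => h.trans hadj.reachable, fun h => h.trans hadj.symm.reachable⟩
              simp only [x, this]
            rw [Finset.sum_pair hab, edgeVec_mk]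
            simp [hx, hab, Ne.symm hab, CharTwo.add_self_eq_zero]
    | zero => exact ⟨∅, by simp, by simp⟩
    | add y z _ _ hy hz =>
      obtain ⟨s, hs, hs0⟩ := hy
      obtain ⟨t, ht, ht0⟩ := hz
      refine ⟨s ∪ t, ?_, ?_⟩
      · intro w hw
        by_contra hw'
        simp only [Finset.coe_union, mem_union, not_or] at hw'
        have h1 : y w = 0 := by
          by_contra h; exact hw'.1 (hs h)
        have h2 : z w = 0 := by
          by_contra h; exact hw'.2 (ht h)
        simp [h1, h2] at hw
      · have e1 : ∑ w ∈ s ∪ t, x w * y w = ∑ w ∈ s, x w * y w := by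
          refine (Finset.sum_subset Finset.subset_union_left fun w _ hw => ?_).symm
          have : y w = 0 := by
            by_contra h; exact hw (hs h)
          simp [this]
        have e2 : ∑ w ∈ s ∪ t, x w * z w = ∑ w ∈ t, x w * z w := by
          refine (Finset.sum_subset Finset.subset_union_right fun w _ hw => ?_).symm
          have : z w = 0 := by
            by_contra h; exact hw (ht h)
          simp [this]
        simp only [Pi.add_apply, mul_add, Finset.sum_add_distrib, e1, e2, hs0, ht0, add_zero]
    | smul c y _ hy =>
      obtain ⟨s, hs, hs0⟩ := hy
      refine ⟨s, fun w hw => hs fun h => hw (by simp [h]), ?_⟩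
      have : ∑ w ∈ s, x w * (c • y) w = c * ∑ w ∈ s, x w * y w := by
        rw [Finset.mul_sum]
        exact Finset.sum_congr rfl fun w _ => by simp only [Pi.smul_apply, smul_eq_mul]; ring
      rw [this, hs0, mul_zero]
  obtain ⟨s, hs, hs0⟩ := key _ h
  have hne : u ≠ v := fun h => huv (h ▸ Reachable.refl u)
  have hu : u ∈ s := by
    apply hs
    simp [edgeVec_mk, hne]
  rw [Finset.sum_eq_single_of_mem u hu] at hs0
  · simp [x, edgeVec_mk, hne] at hs0
  · intro w _ hw
    by_cases hwv : w = v
    · subst hwv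
      simp [x, huv]
    · simp [edgeVec_mk, hw, hwv]

lemma fromEdgeSet_insert_eq {V : Type*} (F : Set (Sym2 V)) (u v : V) :
    fromEdgeSet (insert s(u, v) F) = fromEdgeSet F ⊔ edge u v := by
  rw [edge, ← fromEdgeSet_union, union_singleton]

lemma linearIndepOn_edgeVec {V : Type*} {F : Set (Sym2 V)} (hfin : F.Finite)
    (hloop : ∀ e ∈ F, ¬ e.IsDiag) (hF : (fromEdgeSet F).IsAcyclic) :
    LinearIndepOn (ZMod 2) edgeVec F := by
  induction F, hfin using Set.Finite.induction_on with
  | empty => exact linearIndepOn_empty _ _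
  | @insert e F he _ ih =>
    induction e with
    | h u v =>
      rw [fromEdgeSet_insert_eq, isAcyclic_sup_fromEdgeSet_iff] at hF
      refine (ih (fun e he => hloop e (mem_insert_of_mem _ he)) hF.1).insert fun hmem => ?_
      have huv : u ≠ v := by simpa using hloop _ (mem_insert _ _)
      rcases hF.2 (reachable_of_edgeVec_mem_span hmem) with h | h
      · exact huv h
      · exact he ((fromEdgeSet_adj F).1 h).1

/-- The cycle matroid (graphic matroid) of a finite simple graph: the ground set is the set of
edges, and a set of edges is independent when it is the edge set of a forest. -/
noncomputable def cycleMatroid {V : Type*} [Finite V] (G : SimpleGraph V) :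
    Matroid (Sym2 V) :=
  (IndepMatroid.ofFinite (E := G.edgeSet) (Set.toFinite _)
    (fun F => F ⊆ G.edgeSet ∧ (fromEdgeSet F).IsAcyclic)
    ⟨empty_subset _, by simp⟩
    (fun _ _ hJ hIJ => ⟨hIJ.trans hJ.1, hJ.2.anti (fromEdgeSet_mono hIJ)⟩)
    (by
      rintro I J ⟨hIG, hI⟩ ⟨hJG, hJ⟩ hlt
      by_contra! hcon
      have hloop : ∀ F : Set (Sym2 V), F ⊆ G.edgeSet → ∀ e ∈ F, ¬ e.IsDiag :=
        fun F hF e he => G.not_isDiag_of_mem_edgeSet (hF he)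
      have hspan : Submodule.span (ZMod 2) (edgeVec '' J)
          ≤ Submodule.span (ZMod 2) (edgeVec '' I) := by
        rw [Submodule.span_le]
        rintro _ ⟨e, he, rfl⟩
        by_cases heI : e ∈ I
        · exact Submodule.subset_span ⟨e, heI, rfl⟩
        · induction e with
          | h u v =>
            apply edgeVec_mem_span_of_reachable
            by_contra hreach
            refine hcon _ he heI (insert_subset (hJG he) hIG) ?_
            rw [fromEdgeSet_insert_eq]
            exact hI.sup_edge_of_not_reachable hreach
      have hle := Cardinal.toENat.monotone' (Submodule.rank_mono hspan)
      have hIl := linearIndepOn_edgeVec (Set.toFinite I) (hloop I hIG) hI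
      have hJl := linearIndepOn_edgeVec (Set.toFinite J) (hloop J hJG) hJ
      have hle' : J.encard ≤ I.encard := by
        rw [← toENat_rank_span_set hIl, ← toENat_rank_span_set hJl]
        exact hle
      rw [← (Set.toFinite I).cast_ncard_eq, ← (Set.toFinite J).cast_ncard_eq,
        Nat.cast_le] at hle'
      omega)
    (fun _ h => h.1)).matroid

end SimpleGraph

namespace Matroid

/-- The clique `M(K_n)`: the graphic matroid of the complete graph on `n` vertices. -/
noncomputable def clique (n : ℕ) : Matroid (Sym2 (Fin n)) :=
  (⊤ : SimpleGraph (Fin n)).cycleMatroid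

/-- `M` has an `N`-restriction: some restriction `M ↾ X`, `X ⊆ M.E`, is isomorphic to `N`,
that is, it is the image of `N` under a map that is injective on the ground set of `N`. -/
def HasRestriction {α β : Type*} (M : Matroid α) (N : Matroid β) : Prop :=
  ∃ X ⊆ M.E, ∃ (φ : β → α) (hφ : InjOn φ N.E), M ↾ X = N.map φ hφ

/-- A matroid is simple if it has no loops and no parallel elements, that is, no circuits with one
or two elements. -/
def IsSimpleMatroid {α : Type*} (M : Matroid α) : Prop :=
  ∀ C, M.IsCircuit C → C.encard ≠ 1 ∧ C.encard ≠ 2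

end Matroid

/-! ### Modular matrices and modular matroids -/

namespace Matrix

/-- The rank (over `ℝ`) of the set `X` of columns of the integer matrix `A`. -/
noncomputable def columnRank {m n : Type*} (A : Matrix m n ℤ) (X : Set n) : ℕ :=
  Module.finrank ℝ (Submodule.span ℝ ((fun j => fun i => (A i j : ℝ)) '' X))

/-- An integer matrix is `Δ`-modular if each `rank A × rank A` submatrix has determinant of
absolute value at most `Δ`. -/
def IsModular {m n : Type*} (A : Matrix m n ℤ) (Δ : ℕ) : Prop :=
  ∀ (f : Fin (A.columnRank univ) ↪ m) (g : Fin (A.columnRank univ) ↪ n),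
    |(A.submatrix f g).det| ≤ (Δ : ℤ)

end Matrix

namespace Matroid

/-- `M` is a `Δ`-modular matroid: it is represented over `ℝ` by a `Δ`-modular integer matrix whose
columns are indexed by the ground set of `M`. -/
def IsModularMatroid {α : Type*} (M : Matroid α) (Δ : ℕ) : Prop :=
  ∃ (m : ℕ) (A : Matrix (Fin m) M.E ℤ), A.IsModular Δ ∧
    ∀ X : Set M.E, M.eRk (Subtype.val '' X) = (A.columnRank X : ℕ∞)

/-! ### Points, lines and critical elements -/

/-- A point is a maximal rank-1 set of elements. -/
def IsPoint {α : Type*} (M : Matroid α) (P : Set α) : Prop :=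
  Maximal (fun S => S ⊆ M.E ∧ M.eRk S = 1) P

/-- A line is a maximal rank-2 set of elements. -/
def IsLine {α : Type*} (M : Matroid α) (L : Set α) : Prop :=
  Maximal (fun S => S ⊆ M.E ∧ M.eRk S = 2) L

/-- A line is long if it contains at least three points. -/
def IsLongLine {α : Type*} (M : Matroid α) (L : Set α) : Prop :=
  M.IsLine L ∧ 3 ≤ {P | M.IsPoint P ∧ P ⊆ L}.encard

/-- The set of long lines through `f`. -/
def longLinesThrough {α : Type*} (M : Matroid α) (f : α) : Set (Set α) :=
  {L | M.IsLongLine L ∧ f ∈ L}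

/-- The element `f` of `M` is critical (with respect to `Δ`) if the number of long lines through
`f` is greater than `r(Z) + 70 Δ ^ 7`, where `Z` is the union of these lines. -/
def IsCritical {α : Type*} (M : Matroid α) (Δ : ℕ) (f : α) : Prop :=
  f ∈ M.E ∧
    M.eRk (⋃₀ M.longLinesThrough f) + 70 * (Δ : ℕ∞) ^ 7 < (M.longLinesThrough f).encard

end Matroid

/-!
By unique representability of cliques, the representation of `M` can be put into coordinates indexed
by the vertices of the clique, with coordinate sums zero, in which the edge `ij` is a multiple of
`e_i - e_j` (`exists_cliqueFrame_of_acyclic`). The idea is that there is a small set `H` of vertices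
outside which `M` looks like the clique: an element with two nonzero coordinates `i`, `j` outside
`H` is the edge `ij` (`EdgesOutside`).

Suppose that `H` is such a set and that an element `f` has a nonzero coordinate `j` outside `H`.
On each long line through `f` some element other than `f` either is an edge at `j` or is supported
on `H ∪ {j}`. The edges at `j` are independent, so the first kind contributes at most the rank of
the union `Z` of the long lines; the second kind contributes at most the number of elements
supported on `H ∪ {j}` (`Matroid.encard_longLinesThrough_le`). If that number is at most `70 Δ ^ 7`,
then `f` is not critical. So all critical elements are supported on `H`, and there are at most
`70 Δ ^ 7` of them.

The set `H` is built with a prime `p` just above `Δ`. No determinant of the integer representation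
is a nonzero multiple of `p`, so `M` is also represented over `ZMod p`, again in clique
coordinates (`CliquePair`). A sum of coordinates over a vertex set vanishes over `ℝ` if and only if
it vanishes modulo `p`, as this says that the element is spanned by the edges which do not cross a
cut. As `p` residues always have an interval with sum zero, an element has at most `p - 1` positive
and at most `p - 1` negative coordinates (`CliquePair.card_support_le`).

* An element with two coordinates outside the current vertex set that do not cancel forms, with the
  edges of a triangle at the root, a four-point line modulo that set. The minors of a four-point
  line satisfy a three-term Plücker relation with integer entries, and two of the products cannot
  cancel the third if all are odd; so one of the pairs on the line can be contracted and doubles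
  the power of two that divides all determinants. Since determinants are at most `Δ`, this happens
  at most `log₂ Δ` times (`IntegralFrame.exists_hub`).
* The remaining elements with two coordinates outside that are not edges have the form
  `c (e_a - e_b) + z` with `z ≠ 0` supported on the set. Chaining `p` disjoint ones, separated by
  one subset sum, would again contrast an interval of sum zero modulo `p` with positive real sums
  (`CliquePair.false_of_chain`), so `4 (p - 1)` further vertices meet all of them
  (`CliquePair.exists_edgesOutside`).

The elements supported on `n + 1` vertices are counted in coordinates with respect to a basis of
maximal determinant, in which all minors are at most one (`card_le_modularBound`). In each of the
at most `Δ` cosets of the lattice of this basis the coordinates differ by integers, and the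
Sauer–Shelah lemma applies, since a shattered set of three or five coordinates yields a minor above
one.
-/


/-! ### Counting vectors with small minors -/

/-- Every square submatrix (with distinct rows) of the matrix whose columns are the members of `S`
has determinant of absolute value at most one. -/
def MinorsLeOne {ι : Type*} (S : Set (ι → ℝ)) : Prop :=
  ∀ (k : ℕ) (ρ : Fin k → ι) (x : Fin k → ι → ℝ), Function.Injective ρ → (∀ j, x j ∈ S) →
    |(Matrix.of fun i j => x j (ρ i)).det| ≤ 1

/-- The members of `S` differ by integer vectors. -/
def IntegralDifferences {ι : Type*} (S : Set (ι → ℝ)) : Prop :=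
  ∀ x ∈ S, ∀ y ∈ S, ∀ j, ∃ n : ℤ, x j - y j = n

lemma MinorsLeOne.mono {ι : Type*} {S T : Set (ι → ℝ)} (hT : MinorsLeOne T) (h : S ⊆ T) :
    MinorsLeOne S := fun k ρ x hρ hx => hT k ρ x hρ fun j => h (hx j)

lemma MinorsLeOne.abs_apply_le {ι : Type*} {S : Set (ι → ℝ)} (hS : MinorsLeOne S)
    {x : ι → ℝ} (hx : x ∈ S) (i : ι) : |x i| ≤ 1 := by
  have := hS 1 (fun _ => i) (fun _ => x) (Function.injective_of_subsingleton _) (fun _ => hx)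
  simpa using this

/-- The Sauer–Shelah bound for a family that shatters no set with `d + 1` elements. -/
lemma Finset.card_le_sum_choose_of_not_shatters {α : Type*} [Fintype α] [DecidableEq α]
    {𝒜 : Finset (Finset α)} {d : ℕ} (h : ∀ T : Finset α, T.card = d + 1 → ¬ 𝒜.Shatters T) :
    𝒜.card ≤ ∑ k ∈ Finset.range (d + 1), (Fintype.card α).choose k := by
  have hvc : 𝒜.vcDim ≤ d := by
    refine Finset.sup_le fun T hT => ?_
    by_contra hlt
    obtain ⟨T', hT', hc⟩ := Finset.exists_subset_card_eq (show d + 1 ≤ T.card by omega)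
    exact h T' hc ((Finset.mem_shatterer.1 hT).mono_right hT')
  refine (Finset.card_le_card_shatterer 𝒜).trans
    (Finset.card_shatterer_le_sum_vcDim.trans ?_)
  refine Finset.sum_le_sum_of_subset fun k hk => ?_
  rw [Finset.mem_Iic] at hk
  exact Finset.mem_range.2 (by omega)

/-- A family with a coordinate above `1/2` takes at most two values in each other coordinate, and
shatters no three coordinates: a shattered triple yields a `4 × 4` minor of absolute value
`2 * x i`. -/
lemma card_le_of_half_lt {ι : Type*} [Fintype ι] {S : Finset (ι → ℝ)} (i : ι)
    (hint : IntegralDifferences (S : Set (ι → ℝ))) (hmin : MinorsLeOne (S : Set (ι → ℝ)))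
    (hpos : ∀ x ∈ S, 1 / 2 < x i) :
    S.card ≤ ∑ k ∈ Finset.range 3, (Fintype.card ι).choose k := by
  classical
  have hconst : ∀ x ∈ S, ∀ y ∈ S, x i = y i := by
    intro x hx y hy
    obtain ⟨n, hn⟩ := hint x hx y hy i
    have h1 := abs_le.1 (hmin.abs_apply_le hx i)
    have h2 := abs_le.1 (hmin.abs_apply_le hy i)
    have h3 := hpos x hx
    have h4 := hpos y hy
    have h5 : (n : ℝ) < 1 := by linarith
    have h6 : (-1 : ℝ) < n := by linarith
    have h7 : n < 1 := by exact_mod_cast h5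
    have h8 : -1 < n := by exact_mod_cast h6
    have : n = 0 := by omega
    rw [this] at hn
    push_cast at hn
    linarith
  have hstep : ∀ x ∈ S, ∀ y ∈ S, ∀ j, y j < x j → x j = y j + 1 := by
    intro x hx y hy j hlt
    have hij : i ≠ j := by
      rintro rfl
      exact hlt.ne (hconst y hy x hx)
    obtain ⟨n, hn⟩ := hint x hx y hy j
    have hm := hmin 2 ![i, j] ![x, y] (by
      intro a b; fin_cases a <;> fin_cases b <;> simp [hij, hij.symm]) (by
      intro a; fin_cases a <;> simp [hx, hy])
    simp [Matrix.det_fin_two] at hm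
    rw [hconst y hy x hx] at hm
    have h3 := hpos x hx
    have hn0 : (0 : ℝ) < n := by linarith
    have hn1 : 0 < n := by exact_mod_cast hn0
    have h4 : x i * y j - x i * x j = -(x i * n) := by rw [← hn]; ring
    rw [h4, abs_neg, abs_of_pos (by positivity)] at hm
    have hn2 : (n : ℝ) < 2 := by nlinarith
    have hn3 : n < 2 := by exact_mod_cast hn2
    have : n = 1 := by omega
    rw [this] at hn
    push_cast at hn
    linarith
  -- `enc x` is the set of coordinates in which `x` takes the larger of the two values
  let enc : (ι → ℝ) → Finset ι := fun x => Finset.univ.filter fun j => ∃ y ∈ S, y j < x j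
  have henc : ∀ x j, j ∈ enc x ↔ ∃ y ∈ S, y j < x j := fun x j => by simp [enc]
  have hhi : ∀ x ∈ S, ∀ y ∈ S, ∀ j, j ∈ enc x → j ∉ enc y → x j = y j + 1 := by
    intro x hx y hy j hjx hjy
    apply hstep x hx y hy
    by_contra! hle
    obtain ⟨z, hz, hzx⟩ := (henc x j).1 hjx
    exact hjy ((henc y j).2 ⟨z, hz, hzx.trans_le hle⟩)
  have heq : ∀ x ∈ S, ∀ y ∈ S, ∀ j, (j ∈ enc x ↔ j ∈ enc y) → x j = y j := by
    have key : ∀ x ∈ S, ∀ y ∈ S, ∀ j, (j ∈ enc x ↔ j ∈ enc y) → ¬ x j < y j := by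
      intro x hx y hy j hj hlt
      obtain ⟨z, hz, hzx⟩ := (henc x j).1 (hj.2 ((henc y j).2 ⟨x, hx, hlt⟩))
      have h1 := hstep y hy x hx j hlt
      have h2 := hstep x hx z hz j hzx
      have h3 := hstep y hy z hz j (hzx.trans hlt)
      linarith
    intro x hx y hy j hj
    exact le_antisymm (not_lt.1 (key y hy x hx j hj.symm)) (not_lt.1 (key x hx y hy j hj))
  have hinj : Set.InjOn enc S := by
    intro x hx y hy hxy
    funext j
    exact heq x hx y hy j (by rw [hxy])
  rw [← Finset.card_image_of_injOn hinj]
  apply Finset.card_le_sum_choose_of_not_shatters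
  intro T hT hsh
  have hget : ∀ t ⊆ T, ∃ x ∈ S, ∀ j ∈ T, (j ∈ enc x ↔ j ∈ t) := by
    intro t ht
    obtain ⟨u, hu, hut⟩ := hsh ht
    obtain ⟨x, hx, rfl⟩ := Finset.mem_image.1 hu
    refine ⟨x, hx, fun j hj => ?_⟩
    rw [← hut]
    simp [hj]
  obtain ⟨j, k, l, hjk, hjl, hkl, rfl⟩ := Finset.card_eq_three.1 hT
  -- relative to the traces `∅`, `{j, k}`, `{j, l}`, `{k, l}`, the row `i` is constant and the
  -- other rows form the incidence matrix of a triangle, of determinant `±2`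
  obtain ⟨x₀, hx₀, h₀⟩ := hget ∅ (by simp)
  obtain ⟨x₁, hx₁, h₁⟩ := hget {j, k} (by intro a; simp; tauto)
  obtain ⟨x₂, hx₂, h₂⟩ := hget {j, l} (by intro a; simp; tauto)
  obtain ⟨x₃, hx₃, h₃⟩ := hget {k, l} (by intro a; simp; tauto)
  have hi : ∀ x ∈ S, i ∉ enc x := by
    intro x hx hix
    obtain ⟨y, hy, hlt⟩ := (henc x i).1 hix
    exact hlt.ne (hconst y hy x hx)
  have hine : ∀ a ∈ ({j, k, l} : Finset ι), i ≠ a := by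
    rintro a ha rfl
    obtain ⟨x, hx, h⟩ := hget {i} (by simpa using ha)
    exact hi x hx ((h i ha).2 (by simp))
  have hij := hine j (by simp)
  have hik := hine k (by simp)
  have hil := hine l (by simp)
  simp only [Finset.mem_insert, Finset.mem_singleton, forall_eq_or_imp, forall_eq, hjk, hjl, hkl,
    hjk.symm, hjl.symm, hkl.symm, Finset.notMem_empty, or_self, or_false, or_true,
    iff_true, iff_false] at h₀ h₁ h₂ h₃
  have e1j := hhi x₁ hx₁ x₀ hx₀ j h₁.1 h₀.1
  have e1k := hhi x₁ hx₁ x₀ hx₀ k h₁.2.1 h₀.2.1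
  have e1l := heq x₁ hx₁ x₀ hx₀ l (by simp [h₁, h₀])
  have e2j := hhi x₂ hx₂ x₀ hx₀ j h₂.1 h₀.1
  have e2k := heq x₂ hx₂ x₀ hx₀ k (by simp [h₂, h₀])
  have e2l := hhi x₂ hx₂ x₀ hx₀ l h₂.2.2 h₀.2.2
  have e3j := heq x₃ hx₃ x₀ hx₀ j (by simp [h₃, h₀])
  have e3k := hhi x₃ hx₃ x₀ hx₀ k h₃.2.1 h₀.2.1
  have e3l := hhi x₃ hx₃ x₀ hx₀ l h₃.2.2 h₀.2.2
  have hm := hmin 4 ![i, j, k, l] ![x₀, x₁, x₂, x₃] (by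
    intro a b
    fin_cases a <;> fin_cases b <;>
      simp [hij, hik, hil, hjk, hjl, hkl, hij.symm, hik.symm, hil.symm, hjk.symm, hjl.symm,
        hkl.symm]) (by
    intro a; fin_cases a <;> simp [hx₀, hx₁, hx₂, hx₃])
  have hdet : (Matrix.of fun a b => (![x₀, x₁, x₂, x₃] : Fin 4 → ι → ℝ) b
      ((![i, j, k, l] : Fin 4 → ι) a)).det = -(2 * x₀ i) := by
    have c1 := hconst x₁ hx₁ x₀ hx₀
    have c2 := hconst x₂ hx₂ x₀ hx₀
    have c3 := hconst x₃ hx₃ x₀ hx₀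
    simp [Matrix.det_succ_row_zero, Fin.sum_univ_succ, Fin.succAbove, c1, c2, c3, e1j, e1k, e1l,
      e2j, e2k, e2l, e3j, e3k, e3l]
    ring
  rw [hdet, abs_neg, abs_of_pos (by linarith [hpos x₀ hx₀])] at hm
  linarith [hpos x₀ hx₀]

lemma det_half_sub_diagonal :
    (Matrix.of fun i j : Fin 5 => if i = j then (-(1 / 2) : ℝ) else 1 / 2).det = 3 / 2 := by
  simp [Matrix.det_succ_row_zero, Fin.sum_univ_succ, Fin.succAbove]
  norm_num

/-- A family with all coordinates in `[-1/2, 1/2]` shatters no five coordinates: there, all values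
would be `±1/2`, and half of the `5 × 5` matrix `J - 2I` has determinant `3/2`. -/
lemma card_le_of_abs_le_half {ι : Type*} [Fintype ι] {S : Finset (ι → ℝ)}
    (hint : IntegralDifferences (S : Set (ι → ℝ))) (hmin : MinorsLeOne (S : Set (ι → ℝ)))
    (hle : ∀ x ∈ S, ∀ i, |x i| ≤ 1 / 2) :
    S.card ≤ ∑ k ∈ Finset.range 5, (Fintype.card ι).choose k := by
  classical
  have hgap : ∀ x ∈ S, ∀ y ∈ S, ∀ j, y j < x j → x j = 1 / 2 ∧ y j = -(1 / 2) := by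
    intro x hx y hy j hlt
    obtain ⟨n, hn⟩ := hint x hx y hy j
    have h1 := abs_le.1 (hle x hx j)
    have h2 := abs_le.1 (hle y hy j)
    have hn0 : (0 : ℝ) < n := by linarith
    have hn1 : 0 < n := by exact_mod_cast hn0
    have hn2 : (1 : ℝ) ≤ n := by exact_mod_cast hn1
    constructor <;> linarith
  let enc : (ι → ℝ) → Finset ι := fun x => Finset.univ.filter fun j => 0 < x j
  have henc : ∀ x j, j ∈ enc x ↔ 0 < x j := fun x j => by simp [enc]
  have hinj : Set.InjOn enc S := by
    intro x hx y hy hxy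
    funext j
    have hj : 0 < x j ↔ 0 < y j := by rw [← henc, ← henc, hxy]
    rcases lt_trichotomy (x j) (y j) with h | h | h
    · obtain ⟨h1, h2⟩ := hgap y hy x hx j h
      have := hj.2 (by linarith)
      linarith
    · exact h
    · obtain ⟨h1, h2⟩ := hgap x hx y hy j h
      have := hj.1 (by linarith)
      linarith
  rw [← Finset.card_image_of_injOn hinj]
  apply Finset.card_le_sum_choose_of_not_shatters
  intro T hT hsh
  have hget : ∀ t ⊆ T, ∃ x ∈ S, ∀ j ∈ T, (0 < x j ↔ j ∈ t) := by
    intro t ht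
    obtain ⟨u, hu, hut⟩ := hsh ht
    obtain ⟨x, hx, rfl⟩ := Finset.mem_image.1 hu
    refine ⟨x, hx, fun j hj => ?_⟩
    rw [← hut, ← henc]
    simp [hj]
  have hget' : ∀ t ⊆ T, ∃ x ∈ S, ∀ j ∈ T, x j = if j ∈ t then 1 / 2 else -(1 / 2) := by
    intro t ht
    obtain ⟨x, hx, h⟩ := hget t ht
    obtain ⟨y, hy, h'⟩ := hget (T \ t) Finset.sdiff_subset
    refine ⟨x, hx, fun j hj => ?_⟩
    have hxj := h j hj
    have hyj := h' j hj
    simp only [Finset.mem_sdiff, hj, true_and] at hyj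
    split_ifs with hjt
    · exact (hgap x hx y hy j (by
        have := hxj.2 hjt
        have : ¬ 0 < y j := fun h => hyj.1 h hjt
        linarith)).1
    · exact (hgap y hy x hx j (by
        have := hyj.2 hjt
        have : ¬ 0 < x j := fun h => hjt (hxj.1 h)
        linarith)).2
  let e : Fin 5 ≃ T := (T.equivFinOfCardEq hT).symm
  -- the five traces that omit a single coordinate
  choose! x hxS hx using fun i : Fin 5 => hget' (T.erase (e i)) (Finset.erase_subset _ _)
  have hm := hmin 5 (fun i => (e i : ι)) x (Subtype.val_injective.comp e.injective) hxS
  have hmat : (Matrix.of fun i j => x j (e i : ι))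
      = Matrix.of fun i j : Fin 5 => if i = j then (-(1 / 2) : ℝ) else 1 / 2 := by
    ext i j
    simp only [Matrix.of_apply]
    rw [hx j (e i) (e i).2]
    by_cases hij : i = j
    · simp [hij]
    · have : (e i : ι) ≠ e j := fun h => hij (e.injective (Subtype.ext h))
      simp [hij, this]
  rw [hmat, det_half_sub_diagonal] at hm
  norm_num at hm

/-! ### Counting integer vectors with bounded determinants -/

/-- The lattice spanned by the columns of a nonsingular integer matrix has index `|det B|`. -/
lemma Matrix.card_quotient_range_mulVecLin {n : Type*} [Fintype n] [DecidableEq n]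
    (B : Matrix n n ℤ) (hB : B.det ≠ 0) :
    Nat.card ((n → ℤ) ⧸ LinearMap.range B.mulVecLin) = B.det.natAbs := by
  have hinj : Function.Injective B.mulVecLin := by
    intro x y hxy
    have h : B.mulVec (x - y) = 0 := by
      rw [Matrix.mulVec_sub]
      simpa [sub_eq_zero] using hxy
    exact sub_eq_zero.1 (Matrix.eq_zero_of_mulVec_eq_zero hB h)
  let e := LinearEquiv.ofInjective B.mulVecLin hinj
  rw [← Submodule.natAbs_det_equiv (LinearMap.range B.mulVecLin) e]
  have : (LinearMap.range B.mulVecLin).subtype ∘ₗ AddMonoidHom.toIntLinearMap (e : _ →+ _)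
      = Matrix.toLin' B := by
    ext i j
    rfl
  rw [this, LinearMap.det_toLin']

/-- Replacing the columns `ρ i` of an identity matrix by the vectors `x i` gives a matrix whose
determinant is the minor of the `x i` on the rows `ρ i`. -/
lemma Matrix.det_of_replace_columns {n : Type*} [Fintype n] [DecidableEq n] {k : ℕ}
    {ρ : Fin k → n} (hρ : Function.Injective ρ) (x : Fin k → n → ℝ) (N : Matrix n n ℝ)
    (h1 : ∀ i t, N t (ρ i) = x i t)
    (h2 : ∀ s, s ∉ Set.range ρ → ∀ t, N t s = if t = s then 1 else 0) :
    N.det = (Matrix.of fun i j => x j (ρ i)).det := by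
  classical
  rw [N.twoBlockTriangular_det' (fun t => t ∈ Set.range ρ)]
  · have hone : N.toSquareBlockProp (fun t => ¬ t ∈ Set.range ρ) = 1 := by
      ext s t
      simp only [Matrix.toSquareBlockProp, Matrix.one_apply, Subtype.ext_iff]
      exact h2 _ t.2 _
    rw [hone, Matrix.det_one, mul_one]
    let e : Fin k ≃ {t // t ∈ Set.range ρ} := Equiv.ofInjective ρ hρ
    have := Matrix.det_submatrix_equiv_self e (N.toSquareBlockProp fun t => t ∈ Set.range ρ)
    convert! this.symm using 2
    ext i j
    exact (h1 j (ρ i)).symm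
  · intro i hi j hj
    rw [h2 j hj, if_neg]
    rintro rfl
    exact hj hi

/-- The bound on the number of elements of a rank-`n` simple matroid represented by integer vectors
with determinants of absolute value at most `Δ`. There are at most `Δ` cosets of the lattice of a
basis; in each, one term for each of `n` coordinates that may exceed `1/2`, and one term for the
elements without such a coordinate. -/
def modularBound (Δ n : ℕ) : ℕ :=
  Δ * (n * ∑ k ∈ Finset.range 3, n.choose k + ∑ k ∈ Finset.range 5, n.choose k)

/-- The counting lemma, relative to a basis `b` whose determinant is maximal among those that agree
with `b` outside `I`. The coordinates of each element with respect to `b` lie in `[-1, 1]` and all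
their minors are at most one. Each element gets a sign, so that some coordinate is above
`1/2`, or else all lie in `[-1/2, 1/2]`; the signed elements in one coset of the lattice spanned by
`b` differ by integer vectors. -/
lemma card_le_modularBound {E : Type*} {r Δ : ℕ} (a : E → Fin r → ℤ) (b : Fin r → E)
    (I : Finset (Fin r)) (E' : Finset E)
    (hb0 : (Matrix.of fun i t => a (b t) i).det ≠ 0)
    (hbΔ : (Matrix.of fun i t => a (b t) i).det.natAbs ≤ Δ)
    (hmax : ∀ c : Fin r → E, (∀ t ∉ I, c t = b t) → (∀ t ∈ I, c t ∈ E' ∨ c t = b t) →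
      (Matrix.of fun i t => a (c t) i).det.natAbs ≤ (Matrix.of fun i t => a (b t) i).det.natAbs)
    (X : E → Fin r → ℝ)
    (hX : ∀ x i, ∑ t, X x t * (a (b t) i : ℝ) = a x i)
    (hXI : ∀ x ∈ E', ∀ t ∉ I, X x t = 0)
    (hpar : ∀ x ∈ E', ∀ y ∈ E', (a x = a y ∨ a x = -a y) → x = y) :
    E'.card ≤ modularBound Δ I.card := by
  classical
  set B : Matrix (Fin r) (Fin r) ℤ := Matrix.of fun i t => a (b t) i with hB
  let BR : Matrix (Fin r) (Fin r) ℝ := B.map fun z => (z : ℝ)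
  have hBR : BR.det = (B.det : ℝ) := (Int.cast_det B).symm
  have hBR0 : BR.det ≠ 0 := by rw [hBR]; exact_mod_cast hb0
  have hXv : ∀ x, BR.mulVec (X x) = fun i => (a x i : ℝ) := by
    intro x
    funext i
    rw [← hX x i]
    simp [Matrix.mulVec, dotProduct, BR, hB, mul_comm]
  have hBinj : ∀ u v : Fin r → ℝ, BR.mulVec u = BR.mulVec v → u = v := by
    intro u v huv
    have : BR.mulVec (u - v) = 0 := by rw [Matrix.mulVec_sub, huv, sub_self]
    exact sub_eq_zero.1 (Matrix.eq_zero_of_mulVec_eq_zero hBR0 this)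
  have hXb : ∀ s t, X (b s) t = if t = s then 1 else 0 := by
    intro s
    have : X (b s) = Pi.single s 1 := by
      apply hBinj
      rw [hXv]
      funext i
      simp [BR, hB]
    intro t
    rw [this, Pi.single_apply]
  -- the coordinates in `I`, with a sign
  let Y : E → ℝ → I → ℝ := fun x s t => s * X x t
  let S : Set (I → ℝ) := {y | ∃ x ∈ E', ∃ s : ℝ, (s = 1 ∨ s = -1) ∧ y = Y x s}
  have hS : MinorsLeOne S := by
    intro k ρ y hρ hy
    choose x hxE s hs hy using hy
    let ρ' : Fin k → Fin r := fun i => ρ i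
    have hρ' : Function.Injective ρ' := Subtype.val_injective.comp hρ
    let c : Fin r → E := fun t => if h : ∃ i, ρ' i = t then x h.choose else b t
    have hcρ : ∀ i, c (ρ' i) = x i := by
      intro i
      have h : ∃ j, ρ' j = ρ' i := ⟨i, rfl⟩
      simp only [c, dif_pos h]
      rw [hρ' h.choose_spec]
    have hcb : ∀ t, t ∉ Set.range ρ' → c t = b t := by
      intro t ht
      have h : ¬ ∃ j, ρ' j = t := fun ⟨j, hj⟩ => ht ⟨j, hj⟩
      simp only [c, dif_neg h]
    have hc := hmax c (fun t ht => hcb t (by rintro ⟨i, rfl⟩; exact ht (ρ i).2)) (by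
      intro t _
      by_cases h : t ∈ Set.range ρ'
      · obtain ⟨i, rfl⟩ := h
        exact Or.inl (by rw [hcρ]; exact hxE i)
      · exact Or.inr (hcb t h))
    let N : Matrix (Fin r) (Fin r) ℝ := Matrix.of fun t s => X (c s) t
    have hN : N.det = (Matrix.of fun i j => X (x j) (ρ' i)).det := by
      apply Matrix.det_of_replace_columns hρ' (fun j => X (x j))
      · intro i t
        simp only [N, Matrix.of_apply, hcρ]
      · intro s hs t
        simp only [N, Matrix.of_apply, hcb s hs, hXb]
    have hmul : ((Matrix.of fun i t => a (c t) i).map fun z => (z : ℝ)) = BR * N := by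
      ext i t
      have := congrFun (hXv (c t)) i
      simp only [Matrix.mulVec, dotProduct] at this
      simp [Matrix.mul_apply, N, this]
    have hdet : (((Matrix.of fun i t => a (c t) i).det : ℤ) : ℝ) = B.det * N.det := by
      rw [← hBR, ← Matrix.det_mul, ← hmul]
      exact Int.cast_det _
    have hle : |N.det| ≤ 1 := by
      have h1 : |(((Matrix.of fun i t => a (c t) i).det : ℤ) : ℝ)| ≤ |((B.det : ℤ) : ℝ)| := by
        have : |(Matrix.of fun i t => a (c t) i).det| ≤ |B.det| := by
          rw [Int.abs_eq_natAbs, Int.abs_eq_natAbs]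
          exact_mod_cast hc
        exact_mod_cast this
      have h2 : 0 < |((B.det : ℤ) : ℝ)| := abs_pos.2 (by exact_mod_cast hb0)
      rw [hdet, abs_mul] at h1
      by_contra! hlt
      nlinarith
    have hsign : (Matrix.of fun i j => y j (ρ i))
        = Matrix.of fun i j => s j * (Matrix.of fun i j => X (x j) (ρ' i)) i j := by
      ext i j
      simp only [Matrix.of_apply, hy j]
      rfl
    rw [hsign, Matrix.det_mul_row, abs_mul, ← hN, Finset.abs_prod]
    have : ∀ i, |s i| = 1 := fun i => by rcases hs i with h | h <;> simp [h]
    simp only [this, Finset.prod_const_one, one_mul]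
    exact hle
  -- the sign `σ x` makes the coordinate `τ x` exceed `1/2`, if some coordinate can be chosen
  have hchoice : ∀ x, ∃ (σ : ℤ) (τ : Option I), (σ = 1 ∨ σ = -1) ∧
      (∀ i, τ = some i → 1 / 2 < Y x σ i) ∧ (τ = none → ∀ i, |Y x σ i| ≤ 1 / 2) := by
    intro x
    by_cases h : ∃ i : I, 1 / 2 < |X x i|
    · obtain ⟨i, hi⟩ := h
      rcases lt_abs.1 hi with hi | hi
      · exact ⟨1, some i, Or.inl rfl, by
          intro j hj; cases hj; simpa [Y] using hi, by simp⟩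
      · exact ⟨-1, some i, Or.inr rfl, by
          intro j hj; cases hj; simpa [Y] using hi, by simp⟩
    · push Not at h
      exact ⟨1, none, Or.inl rfl, by simp, fun _ i => by simpa [Y] using h i⟩
  choose σ τ hσ hτ1 hτ2 using hchoice
  let Q := (Fin r → ℤ) ⧸ LinearMap.range B.mulVecLin
  have hQ : Nat.card Q = B.det.natAbs := B.card_quotient_range_mulVecLin hb0
  have : Finite Q := Nat.finite_of_card_ne_zero (by
    rw [hQ]; exact Int.natAbs_ne_zero.2 hb0)
  have : Fintype Q := Fintype.ofFinite Q
  -- the elements are counted by the coset of the signed element and the chosen coordinate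
  let key : E → Q × Option I := fun x => (Submodule.Quotient.mk (σ x • a x), τ x)
  have hσ' : ∀ x, ((σ x : ℝ) = 1 ∨ (σ x : ℝ) = -1) := fun x => by
    rcases hσ x with h | h <;> simp [h]
  have hinjX : ∀ x ∈ E', ∀ y ∈ E', Y x (σ x) = Y y (σ y) → x = y := by
    intro x hx y hy hxy
    have h1 : ∀ t, (σ x : ℝ) * X x t = σ y * X y t := by
      intro t
      by_cases ht : t ∈ I
      · exact congrFun hxy ⟨t, ht⟩
      · rw [hXI x hx t ht, hXI y hy t ht]; simp
    have h2 : σ x • a x = σ y • a y := by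
      funext i
      have : ((σ x * a x i : ℤ) : ℝ) = ((σ y * a y i : ℤ) : ℝ) := by
        push_cast
        rw [← hX x i, ← hX y i, Finset.mul_sum, Finset.mul_sum]
        refine Finset.sum_congr rfl fun t _ => ?_
        rw [← mul_assoc, ← mul_assoc, h1 t]
      simpa using (by exact_mod_cast this : σ x * a x i = σ y * a y i)
    apply hpar x hx y hy
    rcases hσ x with h | h <;> rcases hσ y with h' | h' <;> rw [h, h'] at h2 <;>
      simp only [one_smul, neg_smul, neg_inj] at h2
    · exact Or.inl h2
    · exact Or.inr h2
    · exact Or.inr (by rw [← h2, neg_neg])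
    · exact Or.inl h2
  have hintX : ∀ x y, (key x).1 = (key y).1 →
      ∀ j : I, ∃ n : ℤ, Y x (σ x) j - Y y (σ y) j = n := by
    intro x y hxy j
    obtain ⟨z, hz⟩ := (Submodule.Quotient.eq _).1 hxy
    refine ⟨z j, ?_⟩
    have : (fun t => (σ x : ℝ) * X x t - σ y * X y t) = fun t => (z t : ℝ) := by
      apply hBinj
      have e1 : BR.mulVec (fun t => (σ x : ℝ) * X x t - σ y * X y t)
          = (σ x : ℝ) • BR.mulVec (X x) - (σ y : ℝ) • BR.mulVec (X y) := by
        rw [← Matrix.mulVec_smul, ← Matrix.mulVec_smul, ← Matrix.mulVec_sub]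
        rfl
      rw [e1, hXv, hXv]
      funext i
      have hzi := congrFun hz i
      simp only [Matrix.mulVecLin_apply, Matrix.mulVec, dotProduct, Pi.sub_apply, Pi.smul_apply,
        smul_eq_mul] at hzi
      simp only [Pi.sub_apply, Pi.smul_apply, smul_eq_mul, Matrix.mulVec, dotProduct, BR,
        Matrix.map_apply]
      exact_mod_cast hzi.symm
    exact congrFun this j
  have hfib : ∀ q : Q × Option I, (E'.filter fun x => key x = q).card ≤
      match q.2 with
      | some _ => ∑ k ∈ Finset.range 3, I.card.choose k
      | none => ∑ k ∈ Finset.range 5, I.card.choose k := by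
    intro q
    set F := E'.filter fun x => key x = q with hF
    have hFE : ∀ x ∈ F, x ∈ E' ∧ key x = q := fun x hx => Finset.mem_filter.1 hx
    let T : Finset (I → ℝ) := F.image fun x => Y x (σ x)
    have hT : T.card = F.card := Finset.card_image_of_injOn fun x hx y hy hxy =>
      hinjX x (hFE x hx).1 y (hFE y hy).1 hxy
    have hTint : IntegralDifferences (T : Set (I → ℝ)) := by
      intro u hu v hv j
      obtain ⟨x, hx, rfl⟩ := Finset.mem_image.1 hu
      obtain ⟨y, hy, rfl⟩ := Finset.mem_image.1 hv
      exact hintX x y (by rw [(hFE x hx).2, (hFE y hy).2]) j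
    have hTmin : MinorsLeOne (T : Set (I → ℝ)) := by
      refine hS.mono fun u hu => ?_
      obtain ⟨x, hx, rfl⟩ := Finset.mem_image.1 hu
      exact ⟨x, (hFE x hx).1, σ x, hσ' x, rfl⟩
    rw [← hT, ← Fintype.card_coe I]
    obtain ⟨g, o⟩ := q
    cases o with
    | some i =>
      apply card_le_of_half_lt i hTint hTmin
      intro u hu
      obtain ⟨x, hx, rfl⟩ := Finset.mem_image.1 hu
      exact hτ1 x i (congrArg Prod.snd (hFE x hx).2)
    | none =>
      apply card_le_of_abs_le_half hTint hTmin
      intro u hu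
      obtain ⟨x, hx, rfl⟩ := Finset.mem_image.1 hu
      exact hτ2 x (congrArg Prod.snd (hFE x hx).2)
  rw [Finset.card_eq_sum_card_fiberwise (f := key) (t := Finset.univ) (fun _ _ => by simp)]
  refine (Finset.sum_le_sum fun q _ => hfib q).trans ?_
  rw [Fintype.sum_prod_type]
  simp only [Fintype.sum_option, Finset.sum_const, Finset.card_univ, Fintype.card_coe,
    smul_eq_mul]
  rw [← Nat.card_eq_fintype_card, hQ, modularBound, add_comm]
  exact Nat.mul_le_mul_right _ hbΔ

/-! ### Clique frames and vertex sums -/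

/-- Families with the same independent sets have the same spanning relations. -/
lemma mem_span_of_linearIndepOn_iff {K K' E W W' : Type*} [DivisionRing K] [DivisionRing K']
    [AddCommGroup W] [Module K W] [AddCommGroup W'] [Module K' W'] {v : E → W} {v' : E → W'}
    (h : ∀ I : Set E, LinearIndepOn K v I ↔ LinearIndepOn K' v' I) {S : Set E} {x : E}
    (hx : v x ∈ Submodule.span K (v '' S)) : v' x ∈ Submodule.span K' (v' '' S) := by
  obtain ⟨b, hbS, -, hspan, hb⟩ :=
    exists_linearIndepOn_extension (linearIndepOn_empty K v) (empty_subset S)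
  have hx' : v x ∈ Submodule.span K (v '' b) := (Submodule.span_le.2 hspan) hx
  refine Submodule.span_mono (image_mono hbS) ?_
  by_cases hxb : x ∈ b
  · exact Submodule.subset_span ⟨x, hxb, rfl⟩
  · by_contra hcon
    have h1 := (h _).2 ((linearIndepOn_insert hxb).2 ⟨(h b).1 hb, hcon⟩)
    exact ((linearIndepOn_insert hxb).1 h1).2 hx'

/-- A vector representation in the standard coordinates of a clique: every vector has coordinate
sum zero, and the element `edge i j` is represented by a multiple of `e_i - e_j`. -/
structure CliqueFrame {K E V : Type*} [Field K] [Fintype V] [DecidableEq V]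
    (u : E → V → K) (edge : V → V → E) : Prop where
  sum_eq_zero : ∀ x, ∑ v, u x v = 0
  edge_eq : ∀ i j, i ≠ j → ∃ c : K, c ≠ 0 ∧ u (edge i j) = c • (Pi.single i 1 - Pi.single j 1)

/-- The clique elements with both ends in `U`. -/
def innerEdges {E V : Type*} (edge : V → V → E) (U : Finset V) : Set E :=
  {x | ∃ i ∈ U, ∃ j ∈ U, i ≠ j ∧ x = edge i j}

namespace CliqueFrame

variable {K E V : Type*} [Field K] [Fintype V] [DecidableEq V] {u : E → V → K} {edge : V → V → E}

lemma single_sub_single_mem (hu : CliqueFrame u edge) {S : Set E} {i j : V} (hij : i ≠ j)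
    (h : edge i j ∈ S) :
    (Pi.single i 1 - Pi.single j 1 : V → K) ∈ Submodule.span K (u '' S) := by
  obtain ⟨c, hc, he⟩ := hu.edge_eq i j hij
  have : (Pi.single i 1 - Pi.single j 1 : V → K) = c⁻¹ • u (edge i j) := by
    rw [he, smul_smul, inv_mul_cancel₀ hc, one_smul]
  rw [this]
  exact Submodule.smul_mem _ _ (Submodule.subset_span ⟨_, h, rfl⟩)

/-- The edges inside `U` span all vectors on `U` with coordinate sum zero. -/
lemma mem_span_innerEdges (hu : CliqueFrame u edge) (U : Finset V) (g : V → K)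
    (hg : ∀ v ∉ U, g v = 0) (hsum : ∑ v ∈ U, g v = 0) :
    g ∈ Submodule.span K (u '' innerEdges edge U) := by
  rcases U.eq_empty_or_nonempty with rfl | ⟨o, ho⟩
  · have : g = 0 := funext fun v => hg v (by simp)
    rw [this]
    exact Submodule.zero_mem _
  · have hg' : g = ∑ v ∈ U, g v • (Pi.single v 1 - Pi.single o 1 : V → K) := by
      simp only [smul_sub, Finset.sum_sub_distrib, ← Finset.sum_smul, hsum, zero_smul, sub_zero]
      funext w
      by_cases hw : w ∈ U
      · simp [Finset.sum_apply, Pi.single_apply, hw]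
      · simp [Finset.sum_apply, Pi.single_apply, hw, hg w hw]
    rw [hg']
    refine Submodule.sum_mem _ fun v hv => Submodule.smul_mem _ _ ?_
    by_cases hvo : v = o
    · rw [hvo, sub_self]
      exact Submodule.zero_mem _
    · exact hu.single_sub_single_mem hvo ⟨v, hv, o, ho, hvo, rfl⟩

/-- The sum over `U` vanishes on an edge that has both ends in `U` or both ends outside. -/
lemma sum_innerEdges (hu : CliqueFrame u edge) {U W : Finset V} (hUW : W ⊆ U ∨ Disjoint U W)
    {x : E} (hx : x ∈ innerEdges edge W) : ∑ v ∈ U, u x v = 0 := by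
  obtain ⟨i, hi, j, hj, hij, rfl⟩ := hx
  obtain ⟨c, -, he⟩ := hu.edge_eq i j hij
  rw [he]
  simp only [Pi.smul_apply, Pi.sub_apply, ← Finset.smul_sum, Finset.sum_sub_distrib]
  rcases hUW with h | h
  · simp [h hi, h hj]
  · simp [Finset.disjoint_right.1 h hi, Finset.disjoint_right.1 h hj]

end CliqueFrame

/-- Two representations of one matroid, over `ℝ` and over `ZMod p`, both in the standard
coordinates of the same clique. -/
structure CliquePair {E V : Type*} [Fintype V] [DecidableEq V] (p : ℕ) [Fact p.Prime]
    (u : E → V → ℝ) (w : E → V → ZMod p) (edge : V → V → E) : Prop where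
  real : CliqueFrame u edge
  modp : CliqueFrame w edge
  indep_iff : ∀ I : Set E, LinearIndepOn ℝ u I ↔ LinearIndepOn (ZMod p) w I

/-- The pigeonhole principle for the `p + 1` partial sums of `p` residues. -/
lemma ZMod.exists_sum_Ico_eq_zero {p : ℕ} [NeZero p] (g : ℕ → ZMod p) :
    ∃ s t, s < t ∧ t ≤ p ∧ ∑ i ∈ Finset.Ico s t, g i = 0 := by
  obtain ⟨x, y, hxy, h⟩ := Fintype.exists_ne_map_eq_of_card_lt
    (fun k : Fin (p + 1) => ∑ i ∈ Finset.range k, g i) (by simp [ZMod.card])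
  wlog hlt : x < y generalizing x y
  · exact this y x hxy.symm h.symm (lt_of_le_of_ne (not_lt.1 hlt) hxy.symm)
  refine ⟨x, y, hlt, Nat.lt_succ_iff.1 y.2, ?_⟩
  rw [Finset.sum_Ico_eq_sub _ (le_of_lt hlt), h, sub_self]

lemma Finset.exists_injOn_of_le_card {α : Type*} {P : Finset α} {k : ℕ} (hk : k ≤ P.card)
    (h0 : 0 < k) : ∃ e : ℕ → α, (∀ i < k, e i ∈ P) ∧ ∀ i < k, ∀ j < k, e i = e j → i = j := by
  have hP : 0 < P.card := h0.trans_le hk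
  let f := P.equivFin.symm
  refine ⟨fun i => if h : i < P.card then f ⟨i, h⟩ else f ⟨0, hP⟩, fun i hi => ?_,
    fun i hi j hj hij => ?_⟩
  · simp only [dif_pos (hi.trans_le hk)]
    exact (f _).2
  · simp only [dif_pos (hi.trans_le hk), dif_pos (hj.trans_le hk)] at hij
    simpa using f.injective (Subtype.ext hij)

namespace CliquePair

variable {E V : Type*} [Fintype V] [DecidableEq V] {p : ℕ} [Fact p.Prime]
  {u : E → V → ℝ} {w : E → V → ZMod p} {edge : V → V → E}

/-- A subset sum of the coordinates vanishes exactly if the vector is spanned by the edges that do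
not cross the corresponding cut, so both representations have the same vanishing subset sums. -/
lemma sum_eq_zero_iff (h : CliquePair p u w edge) (x : E) (U : Finset V) :
    ∑ v ∈ U, u x v = 0 ↔ ∑ v ∈ U, w x v = 0 := by
  have key : ∀ {K : Type} [Field K] {z : E → V → K} (_ : CliqueFrame z edge),
      ∑ v ∈ U, z x v = 0 ↔
        z x ∈ Submodule.span K (z '' (innerEdges edge U ∪ innerEdges edge Uᶜ)) := by
    intro K _ z hz
    constructor
    · intro h0
      have h0' : ∑ v ∈ Uᶜ, z x v = 0 := by
        have := Finset.sum_add_sum_compl U (z x)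
        rw [h0, hz.sum_eq_zero, zero_add] at this
        exact this
      have hsplit : z x = (fun v => if v ∈ U then z x v else 0)
          + fun v => if v ∈ Uᶜ then z x v else 0 := by
        funext v
        by_cases hv : v ∈ U <;> simp [hv]
      rw [hsplit]
      refine Submodule.add_mem _ (Submodule.span_mono (image_mono subset_union_left)
        (hz.mem_span_innerEdges U _ (fun v hv => if_neg hv) ?_))
        (Submodule.span_mono (image_mono subset_union_right)
        (hz.mem_span_innerEdges Uᶜ _ (fun v hv => if_neg hv) ?_))
      · rw [← h0]
        exact Finset.sum_congr rfl fun v hv => if_pos hv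
      · rw [← h0']
        exact Finset.sum_congr rfl fun v hv => if_pos hv
    · intro hmem
      let ℓ : (V → K) →ₗ[K] K := ∑ v ∈ U, LinearMap.proj v
      have hℓ : ∀ g, ℓ g = ∑ v ∈ U, g v := fun g => by simp [ℓ]
      have hle : Submodule.span K (z '' (innerEdges edge U ∪ innerEdges edge Uᶜ))
          ≤ LinearMap.ker ℓ := by
        rw [Submodule.span_le]
        rintro _ ⟨y, hy | hy, rfl⟩
        · exact (hℓ _).trans (hz.sum_innerEdges (Or.inl subset_rfl) hy)
        · exact (hℓ _).trans (hz.sum_innerEdges (Or.inr disjoint_compl_right) hy)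
      exact (hℓ _).symm.trans (hle hmem)
  rw [key h.real, key h.modp]
  exact ⟨mem_span_of_linearIndepOn_iff h.indep_iff,
    mem_span_of_linearIndepOn_iff fun I => (h.indep_iff I).symm⟩

lemma apply_eq_zero_iff (h : CliquePair p u w edge) (x : E) (v : V) : u x v = 0 ↔ w x v = 0 := by
  simpa using h.sum_eq_zero_iff x {v}

/-- Among any `p` coordinates some have sum zero modulo `p`, while a sum of positive reals is not
zero. -/
lemma card_pos_lt (h : CliquePair p u w edge) (x : E) (s : ℝ) :
    (Finset.univ.filter fun v => 0 < s * u x v).card < p := by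
  have hp : 0 < p := (Fact.out : p.Prime).pos
  by_contra! hle
  obtain ⟨e, heP, hinj⟩ := Finset.exists_injOn_of_le_card hle hp
  obtain ⟨a, b, hab, hb, hsum⟩ := ZMod.exists_sum_Ico_eq_zero fun i => w x (e i)
  have hinj' : Set.InjOn e (Finset.Ico a b) := by
    intro i hi j hj hij
    simp only [Finset.coe_Ico, mem_Ico] at hi hj
    exact hinj i (by omega) j (by omega) hij
  rw [← Finset.sum_image (g := e) hinj', ← h.sum_eq_zero_iff x, Finset.sum_image hinj'] at hsum
  have hpos : 0 < ∑ i ∈ Finset.Ico a b, s * u x (e i) := by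
    refine Finset.sum_pos (fun i hi => ?_) ⟨a, by simp [hab]⟩
    have := heP i (by simp only [Finset.mem_Ico] at hi; omega)
    simpa using this
  rw [← Finset.mul_sum, hsum, mul_zero] at hpos
  exact lt_irrefl _ hpos

/-- At most `p - 1` coordinates of each sign. -/
lemma card_support_le (h : CliquePair p u w edge) (x : E) :
    (Finset.univ.filter fun v => u x v ≠ 0).card ≤ 2 * (p - 1) := by
  have h1 := h.card_pos_lt x 1
  have h2 := h.card_pos_lt x (-1)
  have hsub : (Finset.univ.filter fun v => u x v ≠ 0) ⊆
      (Finset.univ.filter fun v => 0 < 1 * u x v) ∪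
        (Finset.univ.filter fun v => 0 < (-1) * u x v) := by
    intro v hv
    have := (Finset.mem_filter.1 hv).2
    simp only [Finset.mem_union, Finset.mem_filter, Finset.mem_univ, true_and]
    rcases lt_or_gt_of_ne this with h | h
    · right; linarith
    · left; linarith
  have := (Finset.card_le_card hsub).trans (Finset.card_union_le _ _)
  omega

/-- There is no sequence of `p` elements, each being `c_i (e_{a_i} - e_{b_i})` off a fixed set `H`,
whose sums over a subset `U` of `H` have the same sign as `c_i`. Link them by the edges
`b_i a_{i+1}`: modulo `p` some interval of them, together with the edges inside `U` and inside
`H \ U`, spans the edge that closes up the chain; over `ℝ` no interval does. -/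
lemma false_of_chain (h : CliquePair p u w edge) {H U : Finset V} (hUH : U ⊆ H)
    (f : ℕ → E) (a b : ℕ → V)
    (haH : ∀ i < p, a i ∉ H) (hbH : ∀ i < p, b i ∉ H)
    (haa : ∀ i < p, ∀ j < p, a i = a j → i = j) (hbb : ∀ i < p, ∀ j < p, b i = b j → i = j)
    (hab : ∀ i < p, ∀ j < p, a i ≠ b j)
    (hsupp : ∀ i < p, ∀ v ∉ H, u (f i) v ≠ 0 → v = a i ∨ v = b i)
    (hadd : ∀ i < p, u (f i) (a i) + u (f i) (b i) = 0)
    (hpos : ∀ i < p, 0 < (∑ v ∈ U, u (f i) v) / u (f i) (a i)) : False := by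
  have hane : ∀ i < p, u (f i) (a i) ≠ 0 := by
    intro i hi h0
    have := hpos i hi
    rw [h0, div_zero] at this
    exact lt_irrefl _ this
  have hwne : ∀ i < p, w (f i) (a i) ≠ 0 := fun i hi =>
    fun h0 => hane i hi ((h.apply_eq_zero_iff _ _).2 h0)
  have hwadd : ∀ i < p, w (f i) (a i) + w (f i) (b i) = 0 := by
    intro i hi
    have := h.sum_eq_zero_iff (f i) {a i, b i}
    rw [Finset.sum_pair (hab i hi i hi), Finset.sum_pair (hab i hi i hi)] at this
    exact this.1 (hadd i hi)
  have hwsupp : ∀ i < p, ∀ v ∉ H, v ≠ a i → v ≠ b i → w (f i) v = 0 := by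
    intro i hi v hv h1 h2
    rw [← h.apply_eq_zero_iff]
    by_contra h0
    rcases hsupp i hi v hv h0 with h | h
    · exact h1 h
    · exact h2 h
  obtain ⟨s, t, hst, htp, hsum⟩ := ZMod.exists_sum_Ico_eq_zero fun i =>
    (∑ v ∈ U, w (f i) v) / w (f i) (a i)
  let S : Set E := f '' Set.Ico s t ∪ {x | ∃ i, s ≤ i ∧ i + 1 < t ∧ x = edge (b i) (a (i + 1))} ∪
    (innerEdges edge U ∪ innerEdges edge (H \ U))
  have hne : b (t - 1) ≠ a s := (hab s (by omega) (t - 1) (by omega)).symm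
  -- modulo `p` the closing edge is spanned
  have hmod : w (edge (b (t - 1)) (a s)) ∈ Submodule.span (ZMod p) (w '' S) := by
    let R : ℕ → V → ZMod p := fun i v => if v ∈ H then (w (f i) (a i))⁻¹ * w (f i) v else 0
    have hlink : ∀ i < p, (Pi.single (b i) 1 - Pi.single (a i) 1 - R i : V → ZMod p)
        = -(w (f i) (a i))⁻¹ • w (f i) := by
      intro i hi
      funext v
      have hba : w (f i) (b i) = -w (f i) (a i) := by
        rw [eq_neg_iff_add_eq_zero, add_comm]; exact hwadd i hi
      have h1 := hwne i hi
      by_cases hv : v ∈ H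
      · have hva : v ≠ a i := fun e => haH i hi (e ▸ hv)
        have hvb : v ≠ b i := fun e => hbH i hi (e ▸ hv)
        simp [R, hv, hva, hvb]
      · by_cases hva : v = a i
        · subst hva
          simp [R, hv, hab i hi i hi, h1]
        · by_cases hvb : v = b i
          · subst hvb
            simp [R, hv, (hab i hi i hi).symm, hba, h1]
          · simp [R, hv, hva, hvb, hwsupp i hi v hv hva hvb]
    have hind : ∀ m, s + 1 ≤ m → m ≤ t →
        (Pi.single (b (m - 1)) 1 - Pi.single (a s) 1 - ∑ i ∈ Finset.Ico s m, R i : V → ZMod p)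
          ∈ Submodule.span (ZMod p) (w '' S) := by
      intro m hm
      induction m, hm using Nat.le_induction with
      | base =>
        intro _
        rw [Nat.Ico_succ_singleton, Finset.sum_singleton, Nat.add_sub_cancel,
          hlink s (by omega)]
        exact Submodule.smul_mem _ _ (Submodule.subset_span
          ⟨_, Or.inl (Or.inl ⟨s, ⟨le_rfl, hst⟩, rfl⟩), rfl⟩)
      | succ m hm ih =>
        intro hmt
        have h1 := ih (by omega)
        have h2 : (Pi.single (b (m - 1)) 1 - Pi.single (a m) 1 : V → ZMod p)
            ∈ Submodule.span (ZMod p) (w '' S) := by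
          refine h.modp.single_sub_single_mem (hab m (by omega) (m - 1) (by omega)).symm
            (Or.inl (Or.inr ⟨m - 1, by omega, by omega, ?_⟩))
          rw [Nat.sub_add_cancel (by omega)]
        have h3 : (Pi.single (b m) 1 - Pi.single (a m) 1 - R m : V → ZMod p)
            ∈ Submodule.span (ZMod p) (w '' S) := by
          rw [hlink m (by omega)]
          exact Submodule.smul_mem _ _ (Submodule.subset_span
            ⟨_, Or.inl (Or.inl ⟨m, ⟨by omega, by omega⟩, rfl⟩), rfl⟩)
        rw [Finset.sum_Ico_succ_top (by omega), Nat.add_sub_cancel]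
        convert Submodule.add_mem _ (Submodule.sub_mem _ h1 h2) h3 using 1
        abel
    have hR : (∑ i ∈ Finset.Ico s t, R i) ∈ Submodule.span (ZMod p) (w '' S) := by
      have hRH : ∀ v ∉ H, (∑ i ∈ Finset.Ico s t, R i) v = 0 := by
        intro v hv
        simp [Finset.sum_apply, R, hv]
      have hRU : ∑ v ∈ U, (∑ i ∈ Finset.Ico s t, R i) v = 0 := by
        simp only [Finset.sum_apply]
        rw [Finset.sum_comm, ← hsum]
        refine Finset.sum_congr rfl fun i _ => ?_
        rw [div_eq_inv_mul, Finset.mul_sum]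
        exact Finset.sum_congr rfl fun v hv => if_pos (hUH hv)
      have hRtot : ∑ v ∈ H, (∑ i ∈ Finset.Ico s t, R i) v = 0 := by
        simp only [Finset.sum_apply]
        rw [Finset.sum_comm]
        refine Finset.sum_eq_zero fun i hi => ?_
        have hip : i < p := by simp only [Finset.mem_Ico] at hi; omega
        have h1 : ∑ v ∈ H, w (f i) v = 0 := by
          have h3 : ∑ v ∈ Hᶜ, w (f i) v = 0 := by
            rw [← hwadd i hip, ← Finset.sum_pair (hab i hip i hip)]
            symm
            apply Finset.sum_subset
            · intro v hv
              simp only [Finset.mem_insert, Finset.mem_singleton] at hv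
              rw [Finset.mem_compl]
              rcases hv with rfl | rfl
              · exact haH i hip
              · exact hbH i hip
            · intro v hv hv'
              simp only [Finset.mem_insert, Finset.mem_singleton, not_or] at hv'
              exact hwsupp i hip v (Finset.mem_compl.1 hv) hv'.1 hv'.2
          have h2 := Finset.sum_add_sum_compl H (w (f i))
          rwa [h.modp.sum_eq_zero, h3, add_zero] at h2
        rw [← mul_zero (w (f i) (a i))⁻¹, ← h1, Finset.mul_sum]
        exact Finset.sum_congr rfl fun v hv => if_pos hv
      set G := ∑ i ∈ Finset.Ico s t, R i with hG
      have hsplit : G = (fun v => if v ∈ U then G v else 0)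
          + fun v => if v ∈ H \ U then G v else 0 := by
        funext v
        by_cases hv : v ∈ U
        · simp [hv]
        · by_cases hvH : v ∈ H
          · simp [hv, hvH]
          · simp [hv, hvH, hRH v hvH]
      rw [hsplit]
      refine Submodule.add_mem _
        (Submodule.span_mono (image_mono fun x hx => Or.inr (Or.inl hx))
          (h.modp.mem_span_innerEdges U _ (fun v hv => if_neg hv) ?_))
        (Submodule.span_mono (image_mono fun x hx => Or.inr (Or.inr hx))
          (h.modp.mem_span_innerEdges (H \ U) _ (fun v hv => if_neg hv) ?_))
      · rw [← hRU]
        exact Finset.sum_congr rfl fun v hv => if_pos hv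
      · have := Finset.sum_sdiff hUH (f := G)
        rw [hRU, hRtot, add_zero] at this
        rw [← this]
        exact Finset.sum_congr rfl fun v hv => if_pos hv
    obtain ⟨c, -, hc⟩ := h.modp.edge_eq _ _ hne
    rw [hc]
    apply Submodule.smul_mem
    have := Submodule.add_mem _ (hind t (by omega) le_rfl) hR
    rwa [sub_add_cancel] at this
  -- over `ℝ` a linear functional separates this edge from the span
  have hreal := mem_span_of_linearIndepOn_iff (fun I => (h.indep_iff I).symm) hmod
  let d : ℕ → ℝ := fun i => (∑ v ∈ U, u (f i) v) / u (f i) (a i)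
  let A : ℕ → ℝ := fun i => ∑ l ∈ Finset.Ico s i, d l
  -- the values at `a i` and `b i` make `ℓ` vanish on the chain, and add up to a positive number
  -- over the whole interval
  let ℓ : (V → ℝ) →ₗ[ℝ] ℝ := ∑ v ∈ U, LinearMap.proj v +
    ∑ i ∈ Finset.Ico s t, (A i • LinearMap.proj (a i) + A (i + 1) • LinearMap.proj (b i))
  have hℓ : ∀ g, ℓ g = ∑ v ∈ U, g v +
      ∑ i ∈ Finset.Ico s t, (A i * g (a i) + A (i + 1) * g (b i)) := fun g => by simp [ℓ]
  have hinner : ∀ W : Finset V, W ⊆ H → (W ⊆ U ∨ Disjoint U W) → ∀ x ∈ innerEdges edge W,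
      ℓ (u x) = 0 := by
    intro W hWH hW x hx
    rw [hℓ, h.real.sum_innerEdges hW hx, zero_add]
    obtain ⟨i, hi, j, hj, hij, rfl⟩ := hx
    obtain ⟨c, -, hc⟩ := h.real.edge_eq i j hij
    refine Finset.sum_eq_zero fun l hl => ?_
    have hlp : l < p := by simp only [Finset.mem_Ico] at hl; omega
    have e1 : i ≠ a l := fun e => haH l hlp (e ▸ hWH hi)
    have e2 : j ≠ a l := fun e => haH l hlp (e ▸ hWH hj)
    have e3 : i ≠ b l := fun e => hbH l hlp (e ▸ hWH hi)
    have e4 : j ≠ b l := fun e => hbH l hlp (e ▸ hWH hj)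
    simp [hc, e1.symm, e2.symm, e3.symm, e4.symm]
  have hsa : ∀ j, s ≤ j → j < t → ℓ (Pi.single (a j) 1) = A j := by
    intro j hj hjt
    rw [hℓ, Finset.sum_eq_single_of_mem j (Finset.mem_Ico.2 ⟨hj, hjt⟩)]
    · have h1 : a j ∉ U := fun e => haH j (by omega) (hUH e)
      have h2 : b j ≠ a j := (hab j (by omega) j (by omega)).symm
      simp [h1, h2]
    · intro i hi hij
      simp only [Finset.mem_Ico] at hi
      have h1 : a i ≠ a j := fun e => hij (haa i (by omega) j (by omega) e)
      have h2 : b i ≠ a j := (hab j (by omega) i (by omega)).symm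
      simp [h1, h2]
  have hsb : ∀ j, s ≤ j → j < t → ℓ (Pi.single (b j) 1) = A (j + 1) := by
    intro j hj hjt
    rw [hℓ, Finset.sum_eq_single_of_mem j (Finset.mem_Ico.2 ⟨hj, hjt⟩)]
    · have h1 : b j ∉ U := fun e => hbH j (by omega) (hUH e)
      have h2 : a j ≠ b j := hab j (by omega) j (by omega)
      simp [h1, h2]
    · intro i hi hij
      simp only [Finset.mem_Ico] at hi
      have h1 : b i ≠ b j := fun e => hij (hbb i (by omega) j (by omega) e)
      have h2 : a i ≠ b j := hab i (by omega) j (by omega)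
      simp [h1, h2]
  have hker : Submodule.span ℝ (u '' S) ≤ LinearMap.ker ℓ := by
    rw [Submodule.span_le]
    rintro _ ⟨x, (⟨j, ⟨hj, hjt⟩, rfl⟩ | ⟨j, hj, hjt, rfl⟩) | (hx | hx), rfl⟩
    · change ℓ _ = 0
      rw [hℓ, Finset.sum_eq_single_of_mem j (Finset.mem_Ico.2 ⟨hj, hjt⟩)]
      · have h1 := hane j (by omega)
        have h2 : u (f j) (b j) = -u (f j) (a j) := by linarith [hadd j (by omega)]
        have h3 : A (j + 1) = A j + d j := Finset.sum_Ico_succ_top hj _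
        have h4 : ∑ v ∈ U, u (f j) v = d j * u (f j) (a j) := by
          simp only [d]
          field_simp
        rw [h2, h3, h4]
        ring
      · intro i hi hij
        simp only [Finset.mem_Ico] at hi
        have h1 : u (f j) (a i) = 0 := by
          by_contra h0
          rcases hsupp j (by omega) _ (haH i (by omega)) h0 with e | e
          · exact hij (haa i (by omega) j (by omega) e)
          · exact hab i (by omega) j (by omega) e
        have h2 : u (f j) (b i) = 0 := by
          by_contra h0
          rcases hsupp j (by omega) _ (hbH i (by omega)) h0 with e | e
          · exact hab j (by omega) i (by omega) e.symm
          · exact hij (hbb i (by omega) j (by omega) e)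
        rw [h1, h2]
        ring
    · obtain ⟨c, -, hc⟩ := h.real.edge_eq _ _ (hab (j + 1) (by omega) j (by omega)).symm
      change ℓ _ = 0
      rw [hc, map_smul, map_sub, hsb j hj (by omega), hsa (j + 1) (by omega) hjt, sub_self,
        smul_zero]
    · exact hinner U hUH (Or.inl subset_rfl) x hx
    · exact hinner (H \ U) Finset.sdiff_subset (Or.inr Finset.disjoint_sdiff) x hx
  have h0 : ℓ (u (edge (b (t - 1)) (a s))) = 0 := hker hreal
  obtain ⟨c, hc0, hc⟩ := h.real.edge_eq _ _ hne
  rw [hc, map_smul, map_sub, hsb (t - 1) (by omega) (by omega), hsa s le_rfl hst,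
    Nat.sub_add_cancel (by omega)] at h0
  have hAs : A s = 0 := by simp [A]
  have hAt : 0 < A t := Finset.sum_pos (fun i hi => hpos i (by
    simp only [Finset.mem_Ico] at hi; omega)) ⟨s, by simp [hst]⟩
  rw [hAs, sub_zero, smul_eq_mul] at h0
  exact (mul_ne_zero hc0 hAt.ne') h0

end CliquePair

/-! ### Elements that are not edges outside a small set -/

/-- Some subset `U` of `H` separates at least half of a family of vectors that do not vanish
on `H`: toggling a vertex where a vector is nonzero changes its sum over `U`. -/
lemma exists_subset_half_sum_ne_zero {ι V : Type*} [DecidableEq V] (P : Finset ι)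
    (H : Finset V) (g : ι → V → ℝ) (hg : ∀ i ∈ P, ∃ v ∈ H, g i v ≠ 0) :
    ∃ U ⊆ H, P.card ≤ 2 * (P.filter fun i => ∑ v ∈ U, g i v ≠ 0).card := by
  classical
  by_contra! hcon
  have h1 : ∑ U ∈ H.powerset, 2 * (P.filter fun i => ∑ v ∈ U, g i v ≠ 0).card
      < ∑ U ∈ H.powerset, P.card :=
    Finset.sum_lt_sum_of_nonempty ⟨∅, by simp⟩ fun U hU => hcon U (Finset.mem_powerset.1 hU)
  have h2 : ∑ U ∈ H.powerset, (P.filter fun i => ∑ v ∈ U, g i v ≠ 0).card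
      = ∑ i ∈ P, (H.powerset.filter fun U => ∑ v ∈ U, g i v ≠ 0).card := by
    simp only [Finset.card_filter]
    exact Finset.sum_comm
  have h3 : ∀ i ∈ P, H.powerset.card ≤
      2 * (H.powerset.filter fun U => ∑ v ∈ U, g i v ≠ 0).card := by
    intro i hi
    obtain ⟨o, ho, hgo⟩ := hg i hi
    have hle : (H.powerset.filter fun U => ¬ ∑ v ∈ U, g i v ≠ 0).card ≤
        (H.powerset.filter fun U => ∑ v ∈ U, g i v ≠ 0).card := by
      refine Finset.card_le_card_of_injOn (fun U => symmDiff U {o}) (fun U hU => ?_)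
        (fun U _ W _ h => symmDiff_left_injective _ h)
      simp only [Finset.coe_filter, Finset.mem_powerset, not_not, Set.mem_ofPred_eq] at hU ⊢
      refine ⟨fun v hv => ?_, ?_⟩
      · rcases Finset.mem_symmDiff.1 hv with h | h
        · exact hU.1 h.1
        · exact (Finset.mem_singleton.1 h.1) ▸ ho
      · by_cases hoU : o ∈ U
        · have : symmDiff U {o} = U.erase o := by
            ext v
            simp only [Finset.mem_symmDiff, Finset.mem_singleton, Finset.mem_erase]
            by_cases hv : v = o <;> simp [hv, hoU]
          have h4 := Finset.add_sum_erase U (g i) hoU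
          rw [hU.2] at h4
          rw [this]
          intro h5
          rw [h5, add_zero] at h4
          exact hgo h4
        · have : symmDiff U {o} = insert o U := by
            ext v
            simp only [Finset.mem_symmDiff, Finset.mem_singleton, Finset.mem_insert]
            by_cases hv : v = o <;> simp [hv, hoU]
          rw [this, Finset.sum_insert hoU, hU.2, add_zero]
          exact hgo
    have := Finset.card_filter_add_card_filter_not (s := H.powerset) (fun U => ∑ v ∈ U, g i v ≠ 0)
    omega
  have h4 : ∑ i ∈ P, H.powerset.card ≤
      ∑ i ∈ P, 2 * (H.powerset.filter fun U => ∑ v ∈ U, g i v ≠ 0).card :=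
    Finset.sum_le_sum h3
  rw [← Finset.mul_sum, h2, Finset.mul_sum] at h1
  simp only [Finset.sum_const, smul_eq_mul] at h1 h4
  rw [mul_comm] at h4
  omega

/-- Each element with two nonzero coordinates outside `H` is parallel to the clique edge between
these. -/
def EdgesOutside {E V : Type*} [DecidableEq V] (u : E → V → ℝ) (H : Finset V) : Prop :=
  ∀ f, ∀ a ∉ H, ∀ b ∉ H, a ≠ b → u f a ≠ 0 → u f b ≠ 0 →
    ∃ c : ℝ, u f = c • (Pi.single a 1 - Pi.single b 1)

lemma CliqueFrame.edgesOutside_of_card_support_le {E V : Type*} [Fintype V] [DecidableEq V]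
    {u : E → V → ℝ} {edge : V → V → E} {H : Finset V} (hu : CliqueFrame u edge)
    (h2 : ∀ f, (Finset.univ.filter fun v => u f v ≠ 0).card ≤ 2) : EdgesOutside u H := by
  intro f a _ b _ hab ha hb
  have hsub : ({a, b} : Finset V) ⊆ Finset.univ.filter fun v => u f v ≠ 0 := by
    intro v hv
    simp only [Finset.mem_insert, Finset.mem_singleton] at hv
    rcases hv with rfl | rfl <;> simp [ha, hb]
  have heq := Finset.eq_of_subset_of_card_le hsub (by rw [Finset.card_pair hab]; exact h2 f)
  have hzero : ∀ v, v ≠ a → v ≠ b → u f v = 0 := by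
    intro v hva hvb
    by_contra h0
    have : v ∈ ({a, b} : Finset V) := heq ▸ (by simp [h0])
    simp [hva, hvb] at this
  have hsum : u f a + u f b = 0 := by
    rw [← hu.sum_eq_zero f, ← Finset.sum_pair hab]
    exact Finset.sum_subset (Finset.subset_univ _) fun v _ hv => by
      simp only [Finset.mem_insert, Finset.mem_singleton, not_or] at hv
      exact hzero v hv.1 hv.2
  refine ⟨u f a, funext fun v => ?_⟩
  by_cases hva : v = a
  · subst hva; simp [hab]
  · by_cases hvb : v = b
    · subst hvb
      simp [hva]
      linarith
    · simp [hva, hvb, hzero v hva hvb]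

namespace CliquePair

variable {E V : Type*} [Fintype V] [DecidableEq V] {p : ℕ} [Fact p.Prime]
  {u : E → V → ℝ} {w : E → V → ZMod p} {edge : V → V → E}

/-- A hub `H₀` outside which two nonzero coordinates always cancel can be enlarged by `4 (p - 1)`
vertices such that all elements with two coordinates outside are edges: the remaining elements
`c (e_a - e_b) + z`, with `z ≠ 0` supported on `H₀`, give at most `2 (p - 1)` disjoint pairs, since
some subset sum separates half of them, and fewer than `p` can be separated. -/
lemma exists_edgesOutside (h : CliquePair p u w edge) (H₀ : Finset V)
    (hH₀ : ∀ f, ∀ a ∉ H₀, ∀ b ∉ H₀, a ≠ b → u f a ≠ 0 → u f b ≠ 0 → u f a + u f b = 0) :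
    ∃ H, H₀ ⊆ H ∧ H.card ≤ H₀.card + 4 * (p - 1) ∧ EdgesOutside u H := by
  classical
  have hp : 0 < p := (Fact.out : p.Prime).pos
  have hsupp : ∀ f, ∀ a ∉ H₀, ∀ b ∉ H₀, a ≠ b → u f a ≠ 0 → u f b ≠ 0 → ∀ v ∉ H₀, u f v ≠ 0 →
      v = a ∨ v = b := by
    intro f a ha b hb hab hfa hfb v hv hfv
    by_contra! hcon
    have h1 := hH₀ f a ha b hb hab hfa hfb
    have h2 := hH₀ f v hv a ha hcon.1 hfv hfa
    have h3 := hH₀ f v hv b hb hcon.2 hfv hfb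
    apply hfv
    linarith
  let Bad : E → V → V → Prop := fun f a b => a ∉ H₀ ∧ b ∉ H₀ ∧ a ≠ b ∧ u f a ≠ 0 ∧ u f b ≠ 0 ∧
    ¬ ∃ c : ℝ, u f = c • (Pi.single a 1 - Pi.single b 1)
  -- systems of bad elements with disjoint pairs outside `H₀`
  let Good : Finset (V × V) → Prop := fun P =>
    (∀ q ∈ P, ∃ f, Bad f q.1 q.2) ∧
    ∀ q ∈ P, ∀ q' ∈ P, q ≠ q' → q.1 ≠ q'.1 ∧ q.1 ≠ q'.2 ∧ q.2 ≠ q'.1 ∧ q.2 ≠ q'.2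
  have hcard : ∀ P, Good P → P.card ≤ 2 * (p - 1) := by
    intro P hP
    by_contra! hlt
    obtain ⟨q₀, hq₀⟩ : P.Nonempty := Finset.card_pos.1 (by omega)
    obtain ⟨f₀, -⟩ := hP.1 q₀ hq₀
    have : Nonempty E := ⟨f₀⟩
    choose! f hf using hP.1
    have hz : ∀ q ∈ P, ∃ v ∈ H₀, u (f q) v ≠ 0 := by
      intro q hq
      obtain ⟨ha, hb, hab, hfa, hfb, hnot⟩ := hf q hq
      by_contra! hcon
      refine hnot ⟨u (f q) q.1, funext fun v => ?_⟩
      have hsum := hH₀ (f q) _ ha _ hb hab hfa hfb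
      by_cases hva : v = q.1
      · subst hva; simp [hab]
      · by_cases hvb : v = q.2
        · subst hvb
          simp [hva]
          linarith
        · have : u (f q) v = 0 := by
            by_cases hv : v ∈ H₀
            · exact hcon v hv
            · by_contra h0
              rcases hsupp (f q) _ ha _ hb hab hfa hfb v hv h0 with e | e
              · exact hva e
              · exact hvb e
          simp [hva, hvb, this]
    obtain ⟨U, hU, hhalf⟩ := exists_subset_half_sum_ne_zero P H₀ (fun q => u (f q)) hz
    obtain ⟨e, heP, hinj⟩ := Finset.exists_injOn_of_le_card
      (P := P.filter fun q => ∑ v ∈ U, u (f q) v ≠ 0) (k := p) (by omega) hp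
    have heP' : ∀ i < p, e i ∈ P ∧ ∑ v ∈ U, u (f (e i)) v ≠ 0 := fun i hi =>
      Finset.mem_filter.1 (heP i hi)
    -- orient each pair such that the sum over `U` has the sign of the first coordinate
    let fl : ℕ → Prop := fun i => 0 < (∑ v ∈ U, u (f (e i)) v) / u (f (e i)) (e i).1
    let a : ℕ → V := fun i => if fl i then (e i).1 else (e i).2
    let b : ℕ → V := fun i => if fl i then (e i).2 else (e i).1
    have hor : ∀ i, (a i = (e i).1 ∧ b i = (e i).2) ∨ (a i = (e i).2 ∧ b i = (e i).1) := by
      intro i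
      by_cases hfl : fl i <;> simp [a, b, hfl]
    have hdisj : ∀ i < p, ∀ j < p, i ≠ j →
        a i ≠ a j ∧ a i ≠ b j ∧ b i ≠ a j ∧ b i ≠ b j := by
      intro i hi j hj hij
      have hne : e i ≠ e j := fun he => hij (hinj i hi j hj he)
      obtain ⟨d1, d2, d3, d4⟩ := hP.2 _ (heP' i hi).1 _ (heP' j hj).1 hne
      rcases hor i with ⟨h1, h2⟩ | ⟨h1, h2⟩ <;> rcases hor j with ⟨h3, h4⟩ | ⟨h3, h4⟩ <;>
        rw [h1, h2, h3, h4]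
      · exact ⟨d1, d2, d3, d4⟩
      · exact ⟨d2, d1, d4, d3⟩
      · exact ⟨d3, d4, d1, d2⟩
      · exact ⟨d4, d3, d2, d1⟩
    have hbad : ∀ i < p, Bad (f (e i)) (e i).1 (e i).2 := fun i hi => hf _ (heP' i hi).1
    refine h.false_of_chain hU (fun i => f (e i)) a b ?_ ?_ ?_ ?_ ?_ ?_ ?_ ?_
    · intro i hi
      obtain ⟨ha, hb, -⟩ := hbad i hi
      rcases hor i with ⟨h1, -⟩ | ⟨h1, -⟩ <;> rw [h1] <;> assumption
    · intro i hi
      obtain ⟨ha, hb, -⟩ := hbad i hi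
      rcases hor i with ⟨-, h1⟩ | ⟨-, h1⟩ <;> rw [h1] <;> assumption
    · intro i hi j hj he
      by_contra hij
      exact (hdisj i hi j hj hij).1 he
    · intro i hi j hj he
      by_contra hij
      exact (hdisj i hi j hj hij).2.2.2 he
    · intro i hi j hj
      by_cases hij : i = j
      · subst hij
        have := (hbad i hi).2.2.1
        rcases hor i with ⟨h1, h2⟩ | ⟨h1, h2⟩ <;> rw [h1, h2]
        · exact this
        · exact this.symm
      · exact (hdisj i hi j hj hij).2.1
    · intro i hi v hv hfv
      obtain ⟨ha, hb, hab, hfa, hfb, -⟩ := hbad i hi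
      have := hsupp _ _ ha _ hb hab hfa hfb v hv hfv
      rcases hor i with ⟨h1, h2⟩ | ⟨h1, h2⟩ <;> rw [h1, h2]
      · exact this
      · exact this.symm
    · intro i hi
      obtain ⟨ha, hb, hab, hfa, hfb, -⟩ := hbad i hi
      have := hH₀ _ _ ha _ hb hab hfa hfb
      rcases hor i with ⟨h1, h2⟩ | ⟨h1, h2⟩ <;> rw [h1, h2]
      · exact this
      · rw [add_comm]; exact this
    · intro i hi
      obtain ⟨ha, hb, hab, hfa, hfb, -⟩ := hbad i hi
      have hadd := hH₀ _ _ ha _ hb hab hfa hfb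
      by_cases hfl : fl i
      · simp only [a, hfl, if_true]
        exact hfl
      · simp only [a, hfl, if_false]
        have hb' : u (f (e i)) (e i).2 = -u (f (e i)) (e i).1 := by linarith
        rw [hb', div_neg]
        have hne : (∑ v ∈ U, u (f (e i)) v) / u (f (e i)) (e i).1 ≠ 0 :=
          div_ne_zero (heP' i hi).2 hfa
        have : (∑ v ∈ U, u (f (e i)) v) / u (f (e i)) (e i).1 < 0 :=
          lt_of_le_of_ne (not_lt.1 hfl) hne
        linarith
  have hgood : Good ∅ := ⟨by simp, by simp⟩
  -- the pairs of a maximal system meet all further bad elements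
  obtain ⟨P, hPmem, hPmax⟩ := Finset.exists_max_image
    (Finset.univ.filter fun P => Good P) Finset.card ⟨∅, by simp [hgood]⟩
  have hP : Good P := (Finset.mem_filter.1 hPmem).2
  refine ⟨H₀ ∪ (P.image Prod.fst ∪ P.image Prod.snd), Finset.subset_union_left, ?_, ?_⟩
  · have h1 := Finset.card_union_le H₀ (P.image Prod.fst ∪ P.image Prod.snd)
    have h2 := Finset.card_union_le (P.image Prod.fst) (P.image Prod.snd)
    have h3 := Finset.card_image_le (s := P) (f := Prod.fst)
    have h4 := Finset.card_image_le (s := P) (f := Prod.snd)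
    have h5 := hcard P hP
    omega
  · intro f a ha b hb hab hfa hfb
    by_contra hcon
    simp only [Finset.mem_union, Finset.mem_image, not_or] at ha hb
    have hbad : Bad f a b := ⟨ha.1, hb.1, hab, hfa, hfb, hcon⟩
    have hnew : ∀ q ∈ P, a ≠ q.1 ∧ a ≠ q.2 ∧ b ≠ q.1 ∧ b ≠ q.2 := fun q hq =>
      ⟨fun e => ha.2.1 ⟨q, hq, e.symm⟩, fun e => ha.2.2 ⟨q, hq, e.symm⟩,
        fun e => hb.2.1 ⟨q, hq, e.symm⟩, fun e => hb.2.2 ⟨q, hq, e.symm⟩⟩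
    have hnotin : (a, b) ∉ P := fun hm => (hnew _ hm).1 rfl
    have hgood' : Good (insert (a, b) P) := by
      constructor
      · intro q hq
        rcases Finset.mem_insert.1 hq with rfl | hq
        · exact ⟨f, hbad⟩
        · exact hP.1 q hq
      · intro q hq q' hq' hne
        rcases Finset.mem_insert.1 hq with rfl | hq <;>
          rcases Finset.mem_insert.1 hq' with rfl | hq'
        · exact absurd rfl hne
        · exact hnew q' hq'
        · obtain ⟨d1, d2, d3, d4⟩ := hnew q hq
          exact ⟨d1.symm, d3.symm, d2.symm, d4.symm⟩
        · exact hP.2 q hq q' hq' hne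
    have := hPmax _ (Finset.mem_filter.2 ⟨Finset.mem_univ _, hgood'⟩)
    rw [Finset.card_insert_of_notMem hnotin] at this
    omega

end CliquePair

/-! ### Elements whose coordinates do not cancel -/

/-- An alternating form evaluated at two vectors, given modulo the span of its other arguments by
their coordinates along `x` and `y`. -/
lemma AlternatingMap.map_update_update_eq_det {R N ι : Type*} [CommRing R] [AddCommGroup N]
    [Module R N] [DecidableEq ι] (Φ : N [⋀^ι]→ₗ[R] R) (m : ι → N) {s t : ι} (hst : s ≠ t)
    {T : Set ι} (hs : s ∉ T) (ht : t ∉ T) (x y : N) (y₁ y₂ z₁ z₂ : R) {n n' : N}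
    (hn : n ∈ Submodule.span R (m '' T)) (hn' : n' ∈ Submodule.span R (m '' T)) :
    Φ (Function.update (Function.update m s (y₁ • x + y₂ • y + n)) t (z₁ • x + z₂ • y + n')) =
      (y₁ * z₂ - y₂ * z₁) * Φ (Function.update (Function.update m s x) t y) := by
  let A : N → N → R := fun Y Z => Φ (Function.update (Function.update m s Y) t Z)
  have hcomm : ∀ Y Z, A Y Z = Φ (Function.update (Function.update m t Z) s Y) := fun Y Z => by
    simp only [A]
    rw [Function.update_comm hst]
  have hadd1 : ∀ Y Y' Z, A (Y + Y') Z = A Y Z + A Y' Z := fun Y Y' Z => by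
    rw [hcomm, hcomm, hcomm, Φ.map_update_add]
  have hadd2 : ∀ Y Z Z', A Y (Z + Z') = A Y Z + A Y Z' := fun Y Z Z' => Φ.map_update_add _ _ _ _
  have hsmul1 : ∀ c Y Z, A (c • Y) Z = c * A Y Z := fun c Y Z => by
    rw [hcomm, hcomm, Φ.map_update_smul, smul_eq_mul]
  have hsmul2 : ∀ c Y Z, A Y (c • Z) = c * A Y Z := fun c Y Z => by
    simp only [A]
    rw [Φ.map_update_smul, smul_eq_mul]
  have hself : ∀ Y, A Y Y = 0 := fun Y => by
    refine Φ.map_eq_zero_of_eq _ (i := s) (j := t) ?_ hst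
    rw [Function.update_of_ne hst, Function.update_self, Function.update_self]
  have hn2 : ∀ Y, A Y n' = 0 := by
    intro Y
    have hle : Submodule.span R (m '' T) ≤
        LinearMap.ker (Φ.toMultilinearMap.toLinearMap (Function.update m s Y) t) := by
      rw [Submodule.span_le]
      rintro _ ⟨l, hl, rfl⟩
      have hls : l ≠ s := fun e => hs (e ▸ hl)
      have hlt : l ≠ t := fun e => ht (e ▸ hl)
      change Φ (Function.update (Function.update m s Y) t (m l)) = 0
      refine Φ.map_eq_zero_of_eq _ (i := l) (j := t) ?_ hlt
      rw [Function.update_of_ne hlt, Function.update_of_ne hls, Function.update_self]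
    exact hle hn'
  have hn1 : ∀ Z, A n Z = 0 := by
    intro Z
    have hle : Submodule.span R (m '' T) ≤
        LinearMap.ker (Φ.toMultilinearMap.toLinearMap (Function.update m t Z) s) := by
      rw [Submodule.span_le]
      rintro _ ⟨l, hl, rfl⟩
      have hls : l ≠ s := fun e => hs (e ▸ hl)
      have hlt : l ≠ t := fun e => ht (e ▸ hl)
      change Φ (Function.update (Function.update m t Z) s (m l)) = 0
      refine Φ.map_eq_zero_of_eq _ (i := l) (j := s) ?_ hls
      rw [Function.update_of_ne hls, Function.update_of_ne hlt, Function.update_self]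
    rw [hcomm]
    exact hle hn
  have hswap : A y x = -A x y := by
    have := hself (x + y)
    rw [hadd1, hadd2, hadd2, hself, hself] at this
    linear_combination this
  change A _ _ = _ * A x y
  simp only [hadd1, hadd2, hsmul1, hsmul2, hself, hn1, hn2, hswap]
  ring

/-- Six families of integers, all proportional to one family `g`, with factors satisfying the
three-term Plücker relation: if all members are divisible by `2 ^ k`, then all members of one of the
families are divisible by `2 ^ (k + 1)`, since a sum of two odd numbers is not odd. -/
lemma exists_two_pow_succ_dvd {C : Type*} {k : ℕ} (z : Fin 4 → Fin 4 → C → ℤ)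
    (ζ : Fin 4 → Fin 4 → ℝ) (g : C → ℝ) (hz : ∀ i j c, (z i j c : ℝ) = ζ i j * g c)
    (hζ : ζ 0 1 * ζ 2 3 - ζ 0 2 * ζ 1 3 + ζ 0 3 * ζ 1 2 = 0)
    (hdvd : ∀ i j c, (2 : ℤ) ^ k ∣ z i j c) :
    ∃ i j, i < j ∧ ∀ c, (2 : ℤ) ^ (k + 1) ∣ z i j c := by
  by_contra! hcon
  choose m hm using hdvd
  have h2k : (2 : ℤ) ^ k ≠ 0 := by positivity
  have hodd : ∀ i j, i < j → ∃ c, Odd (m i j c) := by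
    intro i j hij
    obtain ⟨c, hc⟩ := hcon i j hij
    refine ⟨c, Int.not_even_iff_odd.1 fun ⟨l, hl⟩ => hc ⟨l, ?_⟩⟩
    rw [hm, hl]
    ring
  have hcross : ∀ i j i' j' c c', m i j c * m i' j' c' = m i' j' c * m i j c' := by
    intro i j i' j' c c'
    have h : z i j c * z i' j' c' = z i' j' c * z i j c' := by
      have : (z i j c : ℝ) * z i' j' c' = z i' j' c * z i j c' := by
        simp only [hz]
        ring
      exact_mod_cast this
    simp only [hm] at h
    have h' : ((2 : ℤ) ^ k * 2 ^ k) * (m i j c * m i' j' c')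
        = ((2 : ℤ) ^ k * 2 ^ k) * (m i' j' c * m i j c') := by linear_combination h
    exact mul_left_cancel₀ (mul_ne_zero h2k h2k) h'
  obtain ⟨c, hc⟩ := hodd 0 1 (by decide)
  have hall : ∀ i j, i < j → Odd (m i j c) := by
    intro i j hij
    obtain ⟨c', hc'⟩ := hodd i j hij
    have := hcross 0 1 i j c c'
    have h1 : Odd (m i j c * m 0 1 c') := this ▸ hc.mul hc'
    exact (Int.odd_mul.1 h1).1
  have hrel : m 0 1 c * m 2 3 c - m 0 2 c * m 1 3 c + m 0 3 c * m 1 2 c = 0 := by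
    have h : z 0 1 c * z 2 3 c - z 0 2 c * z 1 3 c + z 0 3 c * z 1 2 c = 0 := by
      have : (z 0 1 c : ℝ) * z 2 3 c - z 0 2 c * z 1 3 c + z 0 3 c * z 1 2 c = 0 := by
        simp only [hz]
        linear_combination (g c) ^ 2 * hζ
      exact_mod_cast this
    simp only [hm] at h
    have h' : ((2 : ℤ) ^ k * 2 ^ k) *
        (m 0 1 c * m 2 3 c - m 0 2 c * m 1 3 c + m 0 3 c * m 1 2 c) = 0 := by
      linear_combination h
    exact (mul_eq_zero.1 h').resolve_left (mul_ne_zero h2k h2k)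
  have hA := (hall 0 1 (by decide)).mul (hall 2 3 (by decide))
  have hB := (hall 0 2 (by decide)).mul (hall 1 3 (by decide))
  have hC := (hall 0 3 (by decide)).mul (hall 1 2 (by decide))
  have := (hA.sub_odd hB).add_odd hC
  rw [hrel] at this
  exact absurd this (by decide)

/-- A real representation in standard coordinates that comes from the integer vectors `a` by a
linear map. The vertex `0` is the root; without its coordinate the representation has the
same determinants as `a`, up to a common factor. -/
structure IntegralFrame {E : Type*} {r : ℕ} (u : E → Fin (r + 1) → ℝ)
    (edge : Fin (r + 1) → Fin (r + 1) → E) (a : E → Fin r → ℤ) : Prop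
    extends CliqueFrame u edge where
  map_eq : ∃ L : (Fin r → ℝ) →ₗ[ℝ] (Fin (r + 1) → ℝ), ∀ x, u x = L fun i => (a x i : ℝ)
  det_eq : ∃ δ : ℝ, δ ≠ 0 ∧ ∀ c : Fin r → E,
    (Matrix.of fun t i => u (c t) (Fin.succ i)).det
      = δ * ((Matrix.of fun t i => a (c t) i).det : ℤ)

namespace IntegralFrame

variable {E : Type*} {r : ℕ} {u : E → Fin (r + 1) → ℝ}
  {edge : Fin (r + 1) → Fin (r + 1) → E} {a : E → Fin r → ℤ}

lemma det_ne_zero_iff (hu : IntegralFrame u edge a) (c : Fin r → E) :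
    (Matrix.of fun t i => a (c t) i).det ≠ 0 ↔
      (Matrix.of fun t i => u (c t) (Fin.succ i)).det ≠ 0 := by
  obtain ⟨δ, hδ, h⟩ := hu.det_eq
  rw [h]
  simp [hδ]

lemma edge_zero_apply (hu : CliqueFrame u edge) (t : Fin r) {v : Fin (r + 1)} (h0 : v ≠ 0)
    (ht : v ≠ t.succ) : u (edge 0 t.succ) v = 0 := by
  obtain ⟨c, -, he⟩ := hu.edge_eq 0 t.succ (Fin.succ_ne_zero t).symm
  simp [he, h0, ht]

lemma edge_zero_succ_ne_zero (hu : CliqueFrame u edge) (t : Fin r) :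
    u (edge 0 t.succ) t.succ ≠ 0 := by
  obtain ⟨c, hc, he⟩ := hu.edge_eq 0 t.succ (Fin.succ_ne_zero t).symm
  simp [he, hc]

/-- The edges at the root are a basis. -/
lemma det_star_ne_zero (hu : IntegralFrame u edge a) :
    (Matrix.of fun t i => a (edge 0 (Fin.succ t)) i).det ≠ 0 := by
  rw [hu.det_ne_zero_iff fun t => edge 0 t.succ]
  have : (Matrix.of fun t i => u (edge 0 (Fin.succ t)) (Fin.succ i))
      = Matrix.diagonal fun t => u (edge 0 (Fin.succ t)) (Fin.succ t) := by
    ext t i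
    by_cases hti : t = i
    · simp [hti]
    · rw [Matrix.diagonal_apply_ne _ hti]
      exact edge_zero_apply hu.toCliqueFrame t (Fin.succ_ne_zero i)
        fun h => hti (Fin.succ_injective _ h).symm
  rw [this, Matrix.det_diagonal]
  exact Finset.prod_ne_zero_iff.2 fun t _ => edge_zero_succ_ne_zero hu.toCliqueFrame t

/-- If the part of a basis `b` off `H` consists of the edges at the root, then the vectors supported
on `H` have nonzero coordinates with respect to `b` only at the members inside `H`. -/
lemma coord_eq_zero (hu : CliqueFrame u edge) {H : Finset (Fin (r + 1))} {b : Fin r → E}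
    (hin : ∀ t : Fin r, t.succ ∈ H → ∀ v ∉ H, u (b t) v = 0)
    (hout : ∀ t : Fin r, t.succ ∉ H → b t = edge 0 t.succ) {g : Fin (r + 1) → ℝ}
    (hg : ∀ v ∉ H, g v = 0) {x : Fin r → ℝ}
    (hx : ∀ i : Fin r, ∑ t, x t * u (b t) i.succ = g i.succ) (l : Fin r) (hl : l.succ ∉ H) :
    x l = 0 := by
  have h1 := hx l
  rw [hg _ hl, Finset.sum_eq_single l] at h1
  · rw [hout l hl] at h1
    exact (mul_eq_zero.1 h1).resolve_right (edge_zero_succ_ne_zero hu l)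
  · intro t _ htl
    by_cases ht : t.succ ∈ H
    · rw [hin t ht _ hl, mul_zero]
    · rw [hout t ht, edge_zero_apply hu t (Fin.succ_ne_zero l)
        (fun h => htl (Fin.succ_injective _ h).symm), mul_zero]
  · simp

/-- The vertex set `H` carries elements which, in whatever way they are completed to `r` elements,
have a determinant divisible by `2 ^ k`, while the completion by the edges from the root to the
vertices outside `H` has a nonzero determinant. The elements are indexed by the nonroot vertices. -/
def TwoPowDvd (u : E → Fin (r + 1) → ℝ) (edge : Fin (r + 1) → Fin (r + 1) → E)
    (a : E → Fin r → ℤ) (H : Finset (Fin (r + 1))) (k : ℕ) : Prop :=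
  0 ∈ H ∧ ∃ b : Fin r → E, (∀ t : Fin r, t.succ ∈ H → ∀ v ∉ H, u (b t) v = 0) ∧
    (∀ t : Fin r, t.succ ∉ H → b t = edge 0 t.succ) ∧
    (Matrix.of fun t i => a (b t) i).det ≠ 0 ∧
    ∀ c : Fin r → E, (∀ t : Fin r, t.succ ∈ H → c t = b t) →
      (2 : ℤ) ^ k ∣ (Matrix.of fun t i => a (c t) i).det

lemma twoPowDvd_singleton (hu : IntegralFrame u edge a) : TwoPowDvd u edge a {0} 0 :=
  ⟨by simp, fun t => edge 0 t.succ, fun t ht => absurd (Finset.mem_singleton.1 ht)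
    (Fin.succ_ne_zero t), fun _ _ => rfl, hu.det_star_ne_zero, fun _ _ => by simp⟩

lemma TwoPowDvd.mono (hu : CliqueFrame u edge) {H H' : Finset (Fin (r + 1))} {k : ℕ}
    (h : TwoPowDvd u edge a H k) (hH : H ⊆ H') : TwoPowDvd u edge a H' k := by
  obtain ⟨h0, b, hin, hout, hdet, hdvd⟩ := h
  refine ⟨hH h0, b, fun t ht v hv => ?_, fun t ht => hout t fun h => ht (hH h), hdet,
    fun c hc => hdvd c fun t ht => hc t (hH ht)⟩
  by_cases htH : t.succ ∈ H
  · exact hin t htH v fun h => hv (hH h)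
  · rw [hout t htH]
    exact edge_zero_apply hu t (fun h => hv (h ▸ hH h0)) fun h => hv (h ▸ ht)

lemma TwoPowDvd.two_pow_le {H : Finset (Fin (r + 1))} {k Δ : ℕ}
    (hΔ : ∀ c : Fin r → E, (Matrix.of fun t i => a (c t) i).det.natAbs ≤ Δ)
    (h : TwoPowDvd u edge a H k) : 2 ^ k ≤ Δ := by
  obtain ⟨-, b, -, -, hdet, hdvd⟩ := h
  have h1 := Int.natAbs_dvd_natAbs.2 (hdvd b fun _ _ => rfl)
  rw [Int.natAbs_pow] at h1
  exact (Nat.le_of_dvd (Int.natAbs_pos.2 hdet) h1).trans (hΔ b)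

/-- An element with two coordinates outside `H` that do not cancel is not graphic modulo `H`: on its
two outer vertices `x`, `y` it forms a four-point line with the edges of the triangle spanned by
the root, `x` and `y`. So the determinants with two of these four elements at the places of `x` and
`y` satisfy a Plücker relation with nonzero factors, and for some two of them the power of two
doubles. -/
lemma TwoPowDvd.succ (hu : IntegralFrame u edge a) {H : Finset (Fin (r + 1))} {k : ℕ}
    (h : TwoPowDvd u edge a H k) {f : E} {x y : Fin (r + 1)} (hx : x ∉ H) (hy : y ∉ H)
    (hxy : x ≠ y) (hsupp : ∀ v ∉ H, v ≠ x → v ≠ y → u f v = 0) (hfx : u f x ≠ 0)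
    (hfy : u f y ≠ 0) (hfxy : u f x + u f y ≠ 0) :
    TwoPowDvd u edge a (insert x (insert y H)) (k + 1) := by
  obtain ⟨h0, b, hin, hout, hdet, hdvd⟩ := h
  have hcf := hu.toCliqueFrame
  obtain ⟨s, rfl⟩ := Fin.exists_succ_eq.2 (fun e : x = 0 => hx (e ▸ h0))
  obtain ⟨t, rfl⟩ := Fin.exists_succ_eq.2 (fun e : y = 0 => hy (e ▸ h0))
  have hst : s ≠ t := fun e => hxy (e ▸ rfl)
  obtain ⟨δ, hδ, hdetδ⟩ := hu.det_eq
  let Φ : (Fin r → ℝ) [⋀^Fin r]→ₗ[ℝ] ℝ := Matrix.detRowAlternating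
  let dr : E → Fin r → ℝ := fun e i => u e i.succ
  have hΦ : ∀ c : Fin r → E, Φ (fun l => dr (c l))
      = δ * ((Matrix.of fun t i => a (c t) i).det : ℤ) := fun c => hdetδ c
  let T : Set (Fin r) := {l | l.succ ∈ H}
  -- the four elements with their coordinates at the two new vertices
  let q : Fin 4 → E := ![f, edge s.succ t.succ, edge 0 s.succ, edge 0 t.succ]
  obtain ⟨l1, hl1, he1⟩ := hcf.edge_eq s.succ t.succ hxy
  obtain ⟨l2, hl2, he2⟩ := hcf.edge_eq 0 s.succ (Fin.succ_ne_zero s).symm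
  obtain ⟨l3, hl3, he3⟩ := hcf.edge_eq 0 t.succ (Fin.succ_ne_zero t).symm
  have hqsupp : ∀ i, ∀ v ∉ H, v ≠ s.succ → v ≠ t.succ → u (q i) v = 0 := by
    intro i v hv h1 h2
    have hv0 : v ≠ 0 := fun e => hv (e ▸ h0)
    fin_cases i
    · exact hsupp v hv h1 h2
    · simp [q, he1, h1, h2]
    · simp [q, he2, h1, hv0]
    · simp [q, he3, h2, hv0]
  have hspan : ∀ g : Fin (r + 1) → ℝ, (∀ v ∉ H, g v = 0) →
      (fun i : Fin r => g i.succ) ∈ Submodule.span ℝ ((fun l => dr (b l)) '' T) := by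
    intro g hg
    let N : Matrix (Fin r) (Fin r) ℝ := Matrix.of fun l i => u (b l) i.succ
    have hN : IsUnit N.det := ((hu.det_ne_zero_iff b).1 hdet).isUnit
    let z : Fin r → ℝ := Matrix.vecMul (fun i : Fin r => g i.succ) N⁻¹
    have hz : ∀ i : Fin r, ∑ l, z l * u (b l) i.succ = g i.succ := by
      intro i
      have : Matrix.vecMul z N = fun i : Fin r => g i.succ := by
        simp only [z]
        rw [Matrix.vecMul_vecMul, Matrix.nonsing_inv_mul N hN, Matrix.vecMul_one]
      exact congrFun this i
    have hz0 := coord_eq_zero hcf hin hout hg hz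
    have : (fun i : Fin r => g i.succ) = ∑ l, z l • dr (b l) := by
      funext i
      rw [← hz i]
      simp [Finset.sum_apply, dr]
    rw [this]
    refine Submodule.sum_mem _ fun l _ => ?_
    by_cases hl : l.succ ∈ H
    · exact Submodule.smul_mem _ _ (Submodule.subset_span ⟨l, hl, rfl⟩)
    · rw [hz0 l hl, zero_smul]
      exact Submodule.zero_mem _
  have hdecomp : ∀ i, ∃ n ∈ Submodule.span ℝ ((fun l => dr (b l)) '' T),
      dr (q i) = u (q i) s.succ • Pi.single s 1 + u (q i) t.succ • Pi.single t 1 + n := by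
    intro i
    refine ⟨_, hspan (fun v => if v ∈ H then u (q i) v else 0) (fun v hv => if_neg hv), ?_⟩
    funext j
    simp only [dr, Pi.add_apply, Pi.smul_apply, Pi.single_apply, smul_eq_mul, mul_ite, mul_one,
      mul_zero]
    by_cases hjs : j = s
    · subst hjs; simp [hst, hx]
    · by_cases hjt : j = t
      · subst hjt; simp [hjs, hy]
      · by_cases hjH : j.succ ∈ H
        · simp [hjs, hjt, hjH]
        · simp [hjs, hjt, hjH, hqsupp i _ hjH (fun e => hjs (Fin.succ_injective _ e))
            (fun e => hjt (Fin.succ_injective _ e))]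
  let ζ : Fin 4 → Fin 4 → ℝ := fun i j =>
    u (q i) s.succ * u (q j) t.succ - u (q i) t.succ * u (q j) s.succ
  -- all ways to complete the members of `b` inside `H`, and their versions with two of the four
  -- elements at the new vertices
  let C : Type _ := {c : Fin r → E // ∀ l : Fin r, l.succ ∈ H → c l = b l}
  let rep : (Fin r → E) → Fin 4 → Fin 4 → Fin r → E := fun c i j =>
    Function.update (Function.update c s (q i)) t (q j)
  let z : Fin 4 → Fin 4 → C → ℤ := fun i j c =>
    (Matrix.of fun l i' => a (rep c.1 i j l) i').det
  let γ : C → ℝ := fun c => Φ (Function.update (Function.update (fun l => dr (c.1 l)) s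
    (Pi.single s 1)) t (Pi.single t 1))
  have hz : ∀ i j c, δ * (z i j c : ℝ) = ζ i j * γ c := by
    intro i j c
    have h1 : (fun l => dr (rep c.1 i j l)) = Function.update (Function.update
        (fun l => dr (c.1 l)) s (dr (q i))) t (dr (q j)) := by
      funext l
      simp only [rep, Function.update_apply]
      split_ifs <;> rfl
    have hT : (fun l => dr (c.1 l)) '' T = (fun l => dr (b l)) '' T :=
      image_congr fun l hl => congrArg dr (c.2 l hl)
    obtain ⟨n, hn, hqi⟩ := hdecomp i
    obtain ⟨n', hn', hqj⟩ := hdecomp j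
    rw [← hΦ, h1, hqi, hqj]
    exact Φ.map_update_update_eq_det _ hst (T := T) (fun h => hx h) (fun h => hy h) _ _ _ _ _ _
      (hT ▸ hn) (hT ▸ hn')
  have hrep : ∀ (c : C) i j, ∀ l : Fin r, l.succ ∈ H → rep c.1 i j l = b l := by
    intro c i j l hl
    have h1 : l ≠ s := fun e => hx (e ▸ hl)
    have h2 : l ≠ t := fun e => hy (e ▸ hl)
    simp only [rep, Function.update_of_ne h1, Function.update_of_ne h2]
    exact c.2 l hl
  obtain ⟨i, j, hij, hdiv⟩ := exists_two_pow_succ_dvd (k := k) z ζ (fun c => γ c / δ)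
    (fun i j c => by rw [← mul_div_assoc, ← hz, mul_div_cancel_left₀ _ hδ])
    (by simp only [ζ]; ring) (fun i j c => hdvd _ (hrep c i j))
  -- no two of the four elements are parallel modulo `H`; for `f` and the edge between the two new
  -- vertices this is the hypothesis that the coordinates do not cancel
  have hζ : ζ i j ≠ 0 := by
    have e0 : q 0 = f := rfl
    have e1 : q 1 = edge s.succ t.succ := rfl
    have e2 : q 2 = edge 0 s.succ := rfl
    have e3 : q 3 = edge 0 t.succ := rfl
    fin_cases i <;> fin_cases j <;> first
      | exact absurd hij (by decide)
      | skip
    all_goals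
      simp only [ζ, Fin.zero_eta, Fin.mk_one, Fin.reduceFinMk, e0, e1, e2, e3, he1, he2, he3]
      simp [hst, hst.symm, hl1, hl2, hl3, hfx, hfy]
    · intro h
      have h' : l1 * (u f s.succ + u f t.succ) = 0 := by linarith
      exact (mul_ne_zero hl1 hfxy) h'
  let cb : C := ⟨b, fun _ _ => rfl⟩
  have hγ : γ cb ≠ 0 := by
    have hb : rep b 2 3 = b := by
      funext l
      simp only [rep, Function.update_apply]
      split_ifs with h1 h2
      · rw [h1, hout t hy]; rfl
      · rw [h2, hout s hx]; rfl
      · rfl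
    intro h
    have h1 := hz 2 3 cb
    rw [h, mul_zero] at h1
    have h2 : (z 2 3 cb : ℝ) = 0 := (mul_eq_zero.1 h1).resolve_left hδ
    apply hdet
    have h3 : z 2 3 cb = (Matrix.of fun t i => a (b t) i).det := by
      simp only [z, cb, hb]
    rw [← h3]
    exact_mod_cast h2
  refine ⟨by simp [h0], rep b i j, ?_, ?_, ?_, ?_⟩
  · intro l hl v hv
    simp only [Finset.mem_insert, not_or] at hv hl
    by_cases h1 : l = t
    · subst h1
      simp only [rep, Function.update_self]
      exact hqsupp j v hv.2.2 hv.1 hv.2.1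
    · by_cases h2 : l = s
      · subst h2
        simp only [rep, Function.update_of_ne h1, Function.update_self]
        exact hqsupp i v hv.2.2 hv.1 hv.2.1
      · simp only [rep, Function.update_of_ne h1, Function.update_of_ne h2]
        rcases hl with hl | hl | hl
        · exact absurd (Fin.succ_injective _ hl) h2
        · exact absurd (Fin.succ_injective _ hl) h1
        · exact hin l hl v hv.2.2
  · intro l hl
    simp only [Finset.mem_insert, not_or] at hl
    have h1 : l ≠ t := fun e => hl.2.1 (e ▸ rfl)
    have h2 : l ≠ s := fun e => hl.1 (e ▸ rfl)
    simp only [rep, Function.update_of_ne h1, Function.update_of_ne h2]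
    exact hout l hl.2.2
  · intro h
    have h1 : z i j cb = 0 := h
    have h2 := hz i j cb
    rw [h1, Int.cast_zero, mul_zero] at h2
    exact mul_ne_zero hζ hγ h2.symm
  · intro c hc
    have hcs := hc s (by simp)
    have hct := hc t (by simp)
    simp only [rep, Function.update_self, Function.update_of_ne hst] at hcs hct
    have hcC : ∀ l : Fin r, l.succ ∈ H → c l = b l := by
      intro l hl
      rw [hc l (by simp [hl])]
      exact hrep cb i j l hl
    have := hdiv ⟨c, hcC⟩
    have hrc : rep c i j = c := by
      simp only [rep]
      rw [← hcs, Function.update_eq_self, ← hct, Function.update_eq_self]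
    simpa only [z, hrc] using this

/-- There is a vertex set `H` of size at most `1 + k s`, with `2 ^ k ≤ Δ`, modulo which all elements
are graphic, that is, any two nonzero coordinates outside `H` cancel; here `s` bounds the sizes of
the supports. -/
lemma exists_hub (hu : IntegralFrame u edge a) {Δ s : ℕ}
    (hΔ : ∀ c : Fin r → E, (Matrix.of fun t i => a (c t) i).det.natAbs ≤ Δ)
    (hs : ∀ f, (Finset.univ.filter fun v => u f v ≠ 0).card ≤ s) :
    ∃ (H : Finset (Fin (r + 1))) (k : ℕ), 0 ∈ H ∧ 2 ^ k ≤ Δ ∧ H.card ≤ 1 + k * s ∧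
      ∀ f, ∀ x ∉ H, ∀ y ∉ H, x ≠ y → u f x ≠ 0 → u f y ≠ 0 → u f x + u f y = 0 := by
  by_contra! hcon
  have hall : ∀ k, ∃ H, TwoPowDvd u edge a H k ∧ H.card ≤ 1 + k * s := by
    intro k
    induction k with
    | zero => exact ⟨{0}, hu.twoPowDvd_singleton, by simp⟩
    | succ k ih =>
      obtain ⟨H, hH, hcard⟩ := ih
      obtain ⟨f, x, hx, y, hy, hxy, hfx, hfy, hfxy⟩ :=
        hcon H k hH.1 (hH.two_pow_le hΔ) hcard
      let S := Finset.univ.filter fun v => u f v ≠ 0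
      have hS : ∀ v, v ∈ S ↔ u f v ≠ 0 := fun v => by simp [S]
      have hH' := hH.mono (H' := H ∪ (S \ {x, y})) hu.toCliqueFrame Finset.subset_union_left
      have hnew := hH'.succ hu (f := f) (x := x) (y := y) (by simp [hx]) (by simp [hy]) hxy
        (fun v hv hvx hvy => by
          by_contra h0
          apply hv
          simp [hvx, hvy, hS, h0]) hfx hfy hfxy
      refine ⟨_, hnew, ?_⟩
      have hsub : insert x (insert y (H ∪ (S \ {x, y}))) ⊆ H ∪ S := by
        intro v hv
        simp only [Finset.mem_insert, Finset.mem_union, Finset.mem_sdiff,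
          Finset.mem_singleton] at hv ⊢
        rcases hv with rfl | rfl | h | h
        · exact Or.inr ((hS _).2 hfx)
        · exact Or.inr ((hS _).2 hfy)
        · exact Or.inl h
        · exact Or.inr h.1
      have h1 := (Finset.card_le_card hsub).trans (Finset.card_union_le _ _)
      have h2 : S.card ≤ s := hs f
      rw [Nat.add_mul, one_mul]
      omega
  obtain ⟨H, hH, -⟩ := hall Δ
  exact absurd (hH.two_pow_le hΔ) (by have := @Nat.lt_two_pow_self Δ; omega)

end IntegralFrame

/-! ### Elements supported on a set of vertices -/

namespace IntegralFrame

variable {E : Type*} {r : ℕ} {u : E → Fin (r + 1) → ℝ}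
  {edge : Fin (r + 1) → Fin (r + 1) → E} {a : E → Fin r → ℤ}

/-- At most `modularBound Δ n` elements are supported on a set of `n + 1` vertices. The counting
lemma is applied to a basis that is maximal among those consisting of such elements and of the
edges from the root to the other vertices. -/
lemma card_supported_le [Fintype E] (hu : IntegralFrame u edge a) {Δ : ℕ}
    (hΔ : ∀ c : Fin r → E, (Matrix.of fun t i => a (c t) i).det.natAbs ≤ Δ)
    (hpar : ∀ x y, (a x = a y ∨ a x = -a y) → x = y) (Y : Finset (Fin (r + 1))) (h0 : 0 ∈ Y)
    (E' : Finset E) (hE' : ∀ x, x ∈ E' ↔ ∀ v ∉ Y, u x v = 0) :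
    E'.card ≤ modularBound Δ (Y.card - 1) := by
  classical
  have hcf := hu.toCliqueFrame
  let I : Finset (Fin r) := Finset.univ.filter fun t => t.succ ∈ Y
  have hI : ∀ t, t ∈ I ↔ t.succ ∈ Y := fun t => by simp [I]
  have hIcard : I.card = Y.card - 1 := by
    rw [← Finset.card_erase_of_mem h0, ← Finset.card_image_of_injective I (Fin.succ_injective r)]
    congr 1
    ext v
    simp only [Finset.mem_image, hI, Finset.mem_erase]
    constructor
    · rintro ⟨t, ht, rfl⟩
      exact ⟨Fin.succ_ne_zero t, ht⟩
    · rintro ⟨hv, hvY⟩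
      obtain ⟨t, rfl⟩ := Fin.exists_succ_eq.2 hv
      exact ⟨t, hvY, rfl⟩
  let 𝓑 : Finset (Fin r → E) := Finset.univ.filter fun b =>
    ∀ t : Fin r, (t.succ ∈ Y → b t ∈ E') ∧ (t.succ ∉ Y → b t = edge 0 t.succ)
  have h𝓑 : ∀ b, b ∈ 𝓑 ↔ ∀ t : Fin r, (t.succ ∈ Y → b t ∈ E') ∧
      (t.succ ∉ Y → b t = edge 0 t.succ) := fun b => by simp [𝓑]
  have hstar : (fun t : Fin r => edge 0 t.succ) ∈ 𝓑 := by
    rw [h𝓑]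
    exact fun t => ⟨fun ht => (hE' _).2 fun v hv => edge_zero_apply hcf t
      (fun e => hv (e ▸ h0)) fun e => hv (e ▸ ht), fun _ => rfl⟩
  obtain ⟨b, hb, hmax⟩ := Finset.exists_max_image 𝓑
    (fun b => (Matrix.of fun t i => a (b t) i).det.natAbs) ⟨_, hstar⟩
  have hb' := (h𝓑 b).1 hb
  have htr : ∀ c : Fin r → E, (Matrix.of fun i t => a (c t) i).det
      = (Matrix.of fun t i => a (c t) i).det := fun c =>
    (Matrix.det_transpose _).symm
  have hb0 : (Matrix.of fun t i => a (b t) i).det ≠ 0 := by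
    have h1 := hmax _ hstar
    have h2 := Int.natAbs_pos.2 hu.det_star_ne_zero
    exact Int.natAbs_pos.1 (h2.trans_le h1)
  let N : Matrix (Fin r) (Fin r) ℝ := (Matrix.of fun t i => a (b t) i).map fun z => (z : ℝ)
  have hN : IsUnit N.det := by
    rw [isUnit_iff_ne_zero, ← Int.cast_det]
    exact_mod_cast hb0
  let X : E → Fin r → ℝ := fun x => Matrix.vecMul (fun i => (a x i : ℝ)) N⁻¹
  have hX : ∀ x i, ∑ t, X x t * (a (b t) i : ℝ) = a x i := by
    intro x i
    have : Matrix.vecMul (X x) N = fun i => (a x i : ℝ) := by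
      simp only [X]
      rw [Matrix.vecMul_vecMul, Matrix.nonsing_inv_mul N hN, Matrix.vecMul_one]
    exact congrFun this i
  obtain ⟨L, hL⟩ := hu.map_eq
  have hXu : ∀ x v, ∑ t, X x t * u (b t) v = u x v := by
    intro x v
    have h1 : (fun i => (a x i : ℝ)) = ∑ t, X x t • fun i => (a (b t) i : ℝ) := by
      funext i
      rw [← hX x i]
      simp [Finset.sum_apply]
    rw [hL x, h1, map_sum, Finset.sum_apply]
    refine Finset.sum_congr rfl fun t _ => ?_
    rw [map_smul, ← hL]
    rfl
  rw [← hIcard]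
  refine card_le_modularBound a b I E' (by rw [htr]; exact hb0) (by rw [htr]; exact hΔ b)
    (fun c hc1 hc2 => ?_) X hX (fun x hx t ht => ?_) (fun x _ y _ h => hpar x y h)
  · rw [htr, htr]
    refine hmax c ((h𝓑 c).2 fun t => ⟨fun ht => ?_, fun ht => ?_⟩)
    · rcases hc2 t ((hI t).2 ht) with h | h
      · exact h
      · rw [h]
        exact (hb' t).1 ht
    · rw [hc1 t fun h => ht ((hI t).1 h)]
      exact (hb' t).2 ht
  · exact coord_eq_zero hcf (fun s hs => (hE' _).1 ((hb' s).1 hs)) (fun s hs => (hb' s).2 hs)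
      ((hE' x).1 hx) (fun i => hXu x i.succ) t fun h => ht ((hI t).2 h)

end IntegralFrame

/-! ### Standard coordinates of a clique -/

/-- The vector on the vertices with coordinate sum zero and the given coordinates off the root. -/
def rootExtend {K : Type*} [Field K] {r : ℕ} (g : Fin r → K) : Fin (r + 1) → K :=
  Fin.cons (-∑ t, g t) g

/-- `rootExtend` as a linear map. -/
def rootExtendLin (K : Type*) [Field K] (r : ℕ) : (Fin r → K) →ₗ[K] (Fin (r + 1) → K) where
  toFun := rootExtend
  map_add' g h := by
    funext v
    refine Fin.cases ?_ (fun i => ?_) v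
    · simp [rootExtend, Finset.sum_add_distrib, add_comm]
    · simp [rootExtend]
  map_smul' c g := by
    funext v
    refine Fin.cases ?_ (fun i => ?_) v
    · simp [rootExtend, Finset.mul_sum]
    · simp [rootExtend]

lemma rootExtendLin_apply {K : Type*} [Field K] {r : ℕ} (g : Fin r → K) :
    rootExtendLin K r g = rootExtend g := rfl

lemma rootExtend_single {K : Type*} [Field K] {r : ℕ} (t : Fin r) :
    rootExtend (Pi.single t (1 : K)) = Pi.single t.succ 1 - Pi.single 0 1 := by
  funext v
  refine Fin.cases ?_ (fun i => ?_) v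
  · simp [rootExtend, (Fin.succ_ne_zero t).symm]
  · simp [rootExtend, Pi.single_apply]

lemma sum_rootExtend {K : Type*} [Field K] {r : ℕ} (g : Fin r → K) :
    ∑ v, rootExtend g v = 0 := by
  rw [Fin.sum_univ_succ]
  simp [rootExtend]

/-- Cliques are uniquely representable up to a change of basis and scaling. If a family of vectors
has the triangle relations of a clique, and the edges at the root form a basis, then suitable
multiples of these edges serve as `e_t - e_0`: the edges at the vertex `1` fix the multiples, and
the triangles at `1` then show that all other edges are in standard form. -/
lemma exists_cliqueFrame {K E : Type*} [Field K] {r : ℕ} (v : E → Fin r → K)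
    (edge : Fin (r + 1) → Fin (r + 1) → E) (hsymm : ∀ i j, edge i j = edge j i)
    (hstar : LinearIndependent K fun t : Fin r => v (edge 0 t.succ))
    (htri : ∀ i j k, i ≠ j → i ≠ k → j ≠ k →
      ∃ α β : K, α ≠ 0 ∧ β ≠ 0 ∧ v (edge i j) = α • v (edge i k) + β • v (edge j k)) :
    ∃ Φ : (Fin r → K) ≃ₗ[K] (Fin r → K), CliqueFrame (fun x => rootExtend (Φ (v x))) edge := by
  obtain _ | r := r
  · exact ⟨LinearEquiv.refl _ _, fun x => sum_rootExtend _, fun i j hij =>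
      absurd (Fin.ext (by omega)) hij⟩
  let B : Module.Basis (Fin (r + 1)) K (Fin (r + 1) → K) :=
    basisOfLinearIndependentOfCardEqFinrank hstar (by simp)
  have hB : ∀ t, B t = v (edge 0 t.succ) := fun t => by simp [B]
  let o : Fin (r + 1 + 1) := Fin.succ 0
  have ho : o ≠ 0 := Fin.succ_ne_zero _
  have hsc : ∀ t : Fin (r + 1), ∃ (s : K), s ≠ 0 ∧ (t = 0 → s = 1) ∧ (t ≠ 0 →
      ∃ α : K, α ≠ 0 ∧ v (edge o t.succ) = α • (B 0 - s • B t)) := by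
    intro t
    by_cases ht : t = 0
    · exact ⟨1, one_ne_zero, fun _ => rfl, fun h => absurd ht h⟩
    · obtain ⟨α, β, hα, hβ, h⟩ := htri o t.succ 0 (fun e => ht (Fin.succ_injective _ e).symm) ho
        (Fin.succ_ne_zero t)
      refine ⟨-(β / α), neg_ne_zero.2 (div_ne_zero hβ hα), fun h => absurd h ht,
        fun _ => ⟨α, hα, ?_⟩⟩
      rw [h, hB, hB, hsymm o 0, hsymm t.succ 0, smul_sub, smul_smul, mul_neg,
        mul_div_cancel₀ _ hα, neg_smul, sub_neg_eq_add]
  choose s hs0 hs1 hsα using hsc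
  let B' : Module.Basis (Fin (r + 1)) K (Fin (r + 1) → K) :=
    (Pi.basisFun K (Fin (r + 1))).unitsSMul fun t => (Units.mk0 (s t) (hs0 t))⁻¹
  have hB' : ∀ t, B' t = (s t)⁻¹ • Pi.single t 1 := by
    intro t
    simp [B', Module.Basis.unitsSMul_apply, Units.smul_def]
  let Φ := B.equiv B' (Equiv.refl _)
  have hΦ : ∀ t, Φ (B t) = (s t)⁻¹ • Pi.single t 1 := fun t => by
    rw [← hB']; simp [Φ]
  let L : (Fin (r + 1) → K) →ₗ[K] (Fin (r + 1 + 1) → K) := rootExtendLin K (r + 1) ∘ₗ Φ.toLinearMap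
  have hL : ∀ g, rootExtend (Φ g) = L g := fun _ => rfl
  have hLB : ∀ t, L (B t) = (s t)⁻¹ • (Pi.single t.succ 1 - Pi.single 0 1) := by
    intro t
    rw [← hL, hΦ, ← rootExtendLin_apply, map_smul, rootExtendLin_apply, rootExtend_single]
  have hLo : ∀ t : Fin (r + 1), t ≠ 0 → ∃ α : K, α ≠ 0 ∧
      L (v (edge o t.succ)) = α • (Pi.single o 1 - Pi.single t.succ 1) := by
    intro t ht
    obtain ⟨α, hα, h⟩ := hsα t ht
    refine ⟨α, hα, ?_⟩
    rw [h, map_smul, map_sub, map_smul, hLB, hLB, hs1 0 rfl, smul_smul, mul_inv_cancel₀ (hs0 t),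
      inv_one, one_smul, one_smul, sub_sub_sub_cancel_right]
  have hsw : ∀ i j, (∃ c : K, c ≠ 0 ∧ L (v (edge i j)) = c • (Pi.single i 1 - Pi.single j 1)) →
      ∃ c : K, c ≠ 0 ∧ L (v (edge j i)) = c • (Pi.single j 1 - Pi.single i 1) := by
    rintro i j ⟨c, hc, h⟩
    refine ⟨-c, neg_ne_zero.2 hc, ?_⟩
    rw [hsymm, h, neg_smul, ← smul_neg, neg_sub]
  have h0 : ∀ t : Fin (r + 1), ∃ c : K, c ≠ 0 ∧
      L (v (edge t.succ 0)) = c • (Pi.single t.succ 1 - Pi.single 0 1) := fun t =>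
    ⟨(s t)⁻¹, inv_ne_zero (hs0 t), by rw [hsymm, ← hB, hLB]⟩
  refine ⟨Φ, fun x => sum_rootExtend _, fun i j hij => ?_⟩
  simp only [hL]
  by_cases hi : i = 0
  · subst hi
    obtain ⟨t, rfl⟩ := Fin.exists_succ_eq.2 hij.symm
    exact hsw _ _ (h0 t)
  by_cases hj : j = 0
  · subst hj
    obtain ⟨t, rfl⟩ := Fin.exists_succ_eq.2 hij
    exact h0 t
  obtain ⟨t, rfl⟩ := Fin.exists_succ_eq.2 hi
  obtain ⟨t', rfl⟩ := Fin.exists_succ_eq.2 hj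
  by_cases ht : t = 0
  · subst ht
    exact hLo t' fun e => hij (by rw [e])
  by_cases ht' : t' = 0
  · subst ht'
    exact hsw _ _ (hLo t ht)
  have hto : t.succ ≠ o := fun e => ht (Fin.succ_injective _ e)
  have hto' : t'.succ ≠ o := fun e => ht' (Fin.succ_injective _ e)
  obtain ⟨α, β, hα, hβ, h1⟩ := htri t.succ t'.succ o hij hto hto'
  obtain ⟨γ, δ, -, -, h2⟩ := htri t.succ t'.succ 0 hij hi hj
  obtain ⟨x, hx, hLx⟩ := hsw _ _ (hLo t ht)
  obtain ⟨y, hy, hLy⟩ := hsw _ _ (hLo t' ht')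
  obtain ⟨z, hz, hLz⟩ := h0 t
  obtain ⟨z', hz', hLz'⟩ := h0 t'
  have e1 : L (v (edge t.succ t'.succ)) = (α * x) • (Pi.single t.succ 1 - Pi.single o 1)
      + (β * y) • (Pi.single t'.succ 1 - Pi.single o 1) := by
    rw [h1, map_add, map_smul, map_smul, hLx, hLy, smul_smul, smul_smul]
  have e2 : L (v (edge t.succ t'.succ)) = (γ * z) • (Pi.single t.succ 1 - Pi.single 0 1)
      + (δ * z') • (Pi.single t'.succ 1 - Pi.single 0 1) := by
    rw [h2, map_add, map_smul, map_smul, hLz, hLz', smul_smul, smul_smul]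
  -- compare the coordinates at the vertex `o`
  have e3 : -(α * x) - β * y = 0 := by
    have h3 := congrFun (e1.symm.trans e2) o
    simp [hto.symm, hto'.symm, ho] at h3
    linear_combination h3
  refine ⟨α * x, mul_ne_zero hα hx, ?_⟩
  rw [e1, show β * y = -(α * x) by linear_combination -e3, neg_smul, ← sub_eq_add_neg, ← smul_sub,
    sub_sub_sub_cancel_right]

/-! ### From the matroid to vectors -/

/-- If some `r` vectors of a family in dimension `r` are a basis, then the independent sets are
those contained in a basis. -/
lemma linearIndepOn_iff_exists_det_ne_zero {K E : Type*} [Field K] {r : ℕ} (v : E → Fin r → K)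
    (hb : ∃ b : Fin r → E, (Matrix.of fun t i => v (b t) i).det ≠ 0) (I : Set E) :
    LinearIndepOn K v I ↔
      ∃ c : Fin r → E, (Matrix.of fun t i => v (c t) i).det ≠ 0 ∧ I ⊆ range c := by
  have hli : ∀ c : Fin r → E, (Matrix.of fun t i => v (c t) i).det ≠ 0 ↔
      LinearIndependent K fun t => v (c t) := by
    intro c
    rw [← isUnit_iff_ne_zero, ← Matrix.isUnit_iff_isUnit_det]
    exact Matrix.linearIndependent_rows_iff_isUnit.symm
  constructor
  · intro hI
    obtain ⟨J, -, hIJ, hspan, hJ⟩ := exists_linearIndepOn_extension hI (subset_univ I)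
    obtain ⟨b, hb⟩ := hb
    have hb' := (hli b).1 hb
    have htop : ⊤ ≤ Submodule.span K (range fun x : J => v x) := by
      rw [← hb'.span_eq_top_of_card_eq_finrank' (by simp), Submodule.span_le]
      rintro _ ⟨t, rfl⟩
      have := hspan ⟨b t, mem_univ _, rfl⟩
      rwa [image_eq_range] at this
    let B := Module.Basis.mk hJ htop
    have e : Fin r ≃ J := (Pi.basisFun K (Fin r)).indexEquiv B
    refine ⟨fun t => e t, (hli _).2 (LinearIndependent.comp hJ e e.injective), fun x hx => ?_⟩
    exact ⟨e.symm ⟨x, hIJ hx⟩, by simp⟩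
  · rintro ⟨c, hc, hI⟩
    have := (hli c).1 hc
    have hr : LinearIndepOn K v (range c) := by
      have hinj : Function.Injective c := by
        intro s t hst
        exact this.injective (by simp only [hst])
      exact (linearIndepOn_range_iff hinj v).2 this
    exact hr.mono hI

/-- Integer vectors whose determinants are smaller in absolute value than a prime `p` have the same
independent sets over `ℝ` and modulo `p`. -/
lemma linearIndepOn_real_iff_modp {E : Type*} {r Δ p : ℕ} [Fact p.Prime] (a : E → Fin r → ℤ)
    (hΔ : ∀ c : Fin r → E, (Matrix.of fun t i => a (c t) i).det.natAbs ≤ Δ) (hp : Δ < p)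
    (hb : ∃ b : Fin r → E, (Matrix.of fun t i => a (b t) i).det ≠ 0) (I : Set E) :
    LinearIndepOn ℝ (fun x i => (a x i : ℝ)) I ↔
      LinearIndepOn (ZMod p) (fun x i => (a x i : ZMod p)) I := by
  have h1 : ∀ c : Fin r → E, (Matrix.of fun t i => (a (c t) i : ℝ)).det ≠ 0 ↔
      (Matrix.of fun t i => a (c t) i).det ≠ 0 := by
    intro c
    have : (Matrix.of fun t i => (a (c t) i : ℝ)).det
        = ((Matrix.of fun t i => a (c t) i).det : ℤ) := (Int.cast_det _).symm
    rw [this, Int.cast_ne_zero]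
  have h2 : ∀ c : Fin r → E, (Matrix.of fun t i => (a (c t) i : ZMod p)).det ≠ 0 ↔
      (Matrix.of fun t i => a (c t) i).det ≠ 0 := by
    intro c
    have : (Matrix.of fun t i => (a (c t) i : ZMod p)).det
        = ((Matrix.of fun t i => a (c t) i).det : ℤ) := (Int.cast_det _).symm
    rw [this, Ne, Ne, ZMod.intCast_zmod_eq_zero_iff_dvd, not_iff_not]
    constructor
    · intro hdvd
      by_contra h0
      have h3 := Nat.le_of_dvd (Int.natAbs_pos.2 h0) (Int.natCast_dvd.1 hdvd)
      have h4 := hΔ c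
      omega
    · intro h0
      rw [h0]
      exact dvd_zero _
  obtain ⟨b, hb⟩ := hb
  rw [linearIndepOn_iff_exists_det_ne_zero _ ⟨b, (h1 b).2 hb⟩,
    linearIndepOn_iff_exists_det_ne_zero _ ⟨b, (h2 b).2 hb⟩]
  simp only [h1, h2]

/-- A real matrix of rank `r` factors through the restriction to `r` of its rows. -/
lemma Matrix.exists_rows_factor {m n : ℕ} {E : Type*} [Finite E] (A : Matrix (Fin m) E ℝ)
    (hr : Module.finrank ℝ (Submodule.span ℝ (range A.col)) = n) :
    ∃ (ρ : Fin n ↪ Fin m) (C : Matrix (Fin m) (Fin n) ℝ),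
      ∀ x, (fun i => A i x) = C.mulVec fun t => A (ρ t) x := by
  have : Fintype E := Fintype.ofFinite E
  obtain ⟨b, -, -, hspan, hb⟩ :=
    exists_linearIndepOn_extension (linearIndepOn_empty ℝ A.row) (empty_subset univ)
  have : Fintype b := Fintype.ofFinite b
  have hcard : Fintype.card b = n := by
    rw [← hr, ← Matrix.rank_eq_finrank_span_cols, Matrix.rank_eq_finrank_span_row]
    have h1 : Submodule.span ℝ (range A.row) = Submodule.span ℝ (range fun x : b => A.row x) := by
      apply le_antisymm
      · rw [Submodule.span_le, ← image_univ]
        rwa [image_eq_range A.row b] at hspan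
      · rw [Submodule.span_le]
        rintro _ ⟨x, rfl⟩
        exact Submodule.subset_span ⟨x, rfl⟩
    rw [h1]
    exact (finrank_span_eq_card hb).symm
  let e : Fin n ≃ b := (Fintype.equivFinOfCardEq hcard).symm
  let ρ : Fin n ↪ Fin m := ⟨fun t => e t, Subtype.val_injective.comp e.injective⟩
  have hmem : ∀ i, ∃ c : Fin n → ℝ, ∑ t, c t • A.row (ρ t) = A.row i := by
    intro i
    have h1 := hspan ⟨i, mem_univ _, rfl⟩
    have h2 : A.row '' b = range fun t => A.row (ρ t) := by
      rw [image_eq_range, ← e.surjective.range_comp]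
      rfl
    rw [h2] at h1
    exact (Submodule.mem_span_range_iff_exists_fun ℝ).1 h1
  choose C hC using hmem
  refine ⟨ρ, Matrix.of C, fun x => funext fun i => ?_⟩
  have := congrFun (hC i) x
  rw [Finset.sum_apply] at this
  simp only [Matrix.mulVec, dotProduct, Matrix.of_apply]
  exact this.symm

namespace Matroid

variable {α : Type*}

/-- A rank-`r` `Δ`-modular matroid is represented by integer vectors of length `r` with determinants
of absolute value at most `Δ`. -/
lemma IsModularMatroid.exists_vectors {M : Matroid α} [M.Finite] {r Δ : ℕ}
    (hmod : M.IsModularMatroid Δ) (hrank : M.eRank = (r : ℕ∞)) :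
    ∃ a : M.E → Fin r → ℤ,
      (∀ c : Fin r → M.E, (Matrix.of fun t i => a (c t) i).det.natAbs ≤ Δ) ∧
      ∀ I : Set M.E, M.Indep (Subtype.val '' I) ↔ LinearIndepOn ℝ (fun x i => (a x i : ℝ)) I := by
  obtain ⟨m, A, hA, hrk⟩ := hmod
  have hfin : Finite M.E := M.ground_finite.to_subtype
  have hcol : A.columnRank univ = r := by
    have h1 := hrk univ
    rw [image_univ, Subtype.range_coe, eRk_ground, hrank] at h1
    exact_mod_cast h1.symm
  subst hcol
  let AR : Matrix (Fin m) M.E ℝ := fun i j => (A i j : ℝ)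
  obtain ⟨ρ, C, hC⟩ := AR.exists_rows_factor (n := A.columnRank univ) (by
    rw [Matrix.columnRank, image_univ]
    rfl)
  refine ⟨fun x t => A (ρ t) x, fun c => ?_, fun I => ?_⟩
  · by_cases hc : Function.Injective c
    · have h1 := hA ρ ⟨c, hc⟩
      rw [← Matrix.det_transpose] at h1
      have h2 : (Matrix.of fun t i => A (ρ i) (c t)) = (A.submatrix ρ c).transpose := rfl
      have h3 : |(Matrix.of fun t i => A (ρ i) (c t)).det| ≤ (Δ : ℤ) := by rw [h2]; exact h1
      rw [Int.abs_eq_natAbs] at h3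
      exact_mod_cast h3
    · simp only [Function.Injective, not_forall] at hc
      obtain ⟨s, t, hst, hne⟩ := hc
      rw [Matrix.det_zero_of_row_eq hne (by funext i; simp [hst])]
      simp
  · have h1 : LinearIndepOn ℝ (fun x i => AR i x) I ↔
        LinearIndepOn ℝ (fun x t => ((A (ρ t) x : ℤ) : ℝ)) I := by
      constructor
      · intro h
        refine LinearIndependent.of_comp C.mulVecLin ?_
        have h2 : (C.mulVecLin ∘ fun x : I => fun t => ((A (ρ t) x : ℤ) : ℝ))
            = fun x : I => fun i => AR i x := by
          funext x
          exact (hC x).symm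
        rw [h2]
        exact h
      · intro h
        exact LinearIndependent.of_comp (LinearMap.funLeft ℝ ℝ ρ) h
    rw [← h1]
    have hIfin : (Subtype.val '' I).Finite := Set.toFinite _
    rw [indep_iff_eRk_eq_encard_of_finite hIfin, hrk, Subtype.val_injective.encard_image]
    have : Fintype I := Fintype.ofFinite I
    change _ ↔ LinearIndependent ℝ fun x : I => fun i => AR i x
    rw [linearIndependent_iff_card_eq_finrank_span, ← Set.coe_fintypeCard, Nat.cast_inj,
      Matrix.columnRank, Set.finrank, image_eq_range, eq_comm]

/-- The restriction of a matroid to a clique, in terms of a map from the edges. -/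
lemma HasRestriction.exists_clique_map {M : Matroid α} {r : ℕ} (hr : 0 < r)
    (h : M.HasRestriction (clique (r + 1))) :
    ∃ φ : Sym2 (Fin (r + 1)) → M.E,
      InjOn φ (⊤ : SimpleGraph (Fin (r + 1))).edgeSet ∧
      ∀ F ⊆ (⊤ : SimpleGraph (Fin (r + 1))).edgeSet,
        M.Indep (Subtype.val '' (φ '' F)) ↔ (SimpleGraph.fromEdgeSet F).IsAcyclic := by
  classical
  obtain ⟨X, hX, φ, hφ, hres⟩ := h
  have hE : (clique (r + 1)).E = (⊤ : SimpleGraph (Fin (r + 1))).edgeSet := rfl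
  have hXE : X = φ '' (⊤ : SimpleGraph (Fin (r + 1))).edgeSet := by
    have := congrArg Matroid.E hres
    rwa [restrict_ground_eq, map_ground] at this
  have hmem : ∀ e ∈ (⊤ : SimpleGraph (Fin (r + 1))).edgeSet, φ e ∈ M.E := fun e he =>
    hX (hXE ▸ ⟨e, he, rfl⟩)
  obtain ⟨r, rfl⟩ : ∃ k, r = k + 1 := ⟨r - 1, by omega⟩
  have h01 : s(0, 1) ∈ (⊤ : SimpleGraph (Fin (r + 1 + 1))).edgeSet := by simp
  let ψ : Sym2 (Fin (r + 1 + 1)) → M.E := fun e =>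
    if he : e ∈ (⊤ : SimpleGraph (Fin (r + 1 + 1))).edgeSet then ⟨φ e, hmem e he⟩
    else ⟨_, hmem _ h01⟩
  have hψ : ∀ e ∈ (⊤ : SimpleGraph (Fin (r + 1 + 1))).edgeSet, (ψ e : α) = φ e := fun e he => by
    simp only [ψ, dif_pos he]
  refine ⟨ψ, fun e he e' he' heq => hφ he he' ?_, fun F hF => ?_⟩
  · rw [← hψ e he, ← hψ e' he', heq]
  · have himg : Subtype.val '' (ψ '' F) = φ '' F := by
      rw [image_image]
      exact image_congr fun e he => hψ e (hF he)
    have h1 : M.Indep (φ '' F) ↔ (M ↾ X).Indep (φ '' F) := by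
      rw [restrict_indep_iff]
      exact ⟨fun h => ⟨h, hXE ▸ image_mono hF⟩, fun h => h.1⟩
    rw [himg, h1, hres, map_image_indep_iff hF]
    exact ⟨fun h => h.2, fun h => ⟨hF, h⟩⟩

end Matroid

/-- The relations of the clique on the vectors that represent its edges. -/
lemma exists_cliqueFrame_of_acyclic {K E : Type*} [Field K] {r : ℕ} (v : E → Fin r → K)
    (φ : Sym2 (Fin (r + 1)) → E) (hφ : InjOn φ (⊤ : SimpleGraph (Fin (r + 1))).edgeSet)
    (h : ∀ F ⊆ (⊤ : SimpleGraph (Fin (r + 1))).edgeSet,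
      LinearIndepOn K v (φ '' F) ↔ (SimpleGraph.fromEdgeSet F).IsAcyclic) :
    ∃ Φ : (Fin r → K) ≃ₗ[K] (Fin r → K),
      CliqueFrame (fun x => rootExtend (Φ (v x))) fun i j => φ s(i, j) := by
  have hstarA : ∀ (k : Fin (r + 1)) (F : Set (Sym2 (Fin (r + 1)))), (∀ e ∈ F, k ∈ e) →
      (SimpleGraph.fromEdgeSet F).IsAcyclic := by
    intro k F hF
    refine (SimpleGraph.isTree_starGraph (r := k)).isAcyclic.anti ?_
    intro x y hxy
    rw [SimpleGraph.fromEdgeSet_adj] at hxy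
    rw [SimpleGraph.starGraph_adj]
    have := hF _ hxy.1
    rw [Sym2.mem_iff] at this
    exact ⟨hxy.2, this.imp Eq.symm Eq.symm⟩
  refine exists_cliqueFrame v _ (fun i j => by rw [Sym2.eq_swap]) ?_ ?_
  · let F : Set (Sym2 (Fin (r + 1))) := range fun t : Fin r => s(0, t.succ)
    have hF : F ⊆ (⊤ : SimpleGraph (Fin (r + 1))).edgeSet := by
      rintro _ ⟨t, rfl⟩
      simpa using (Fin.succ_ne_zero t).symm
    have hind := (h F hF).2 (hstarA 0 F (by rintro _ ⟨t, rfl⟩; simp))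
    have hinj : Function.Injective fun t : Fin r => φ s(0, t.succ) := by
      intro s t hst
      have := hφ (hF ⟨s, rfl⟩) (hF ⟨t, rfl⟩) hst
      simpa using this
    have hr : φ '' F = range fun t : Fin r => φ s(0, t.succ) := by
      rw [← range_comp]
      rfl
    rw [hr] at hind
    exact (linearIndepOn_range_iff hinj v).1 hind
  · intro i j k hij hik hjk
    have hmem : ∀ {x y : Fin (r + 1)}, x ≠ y →
        s(x, y) ∈ (⊤ : SimpleGraph (Fin (r + 1))).edgeSet := fun h => by simpa using h
    have e1 : s(i, j) ≠ s(i, k) := by simp [hjk, hij.symm]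
    have e2 : s(i, j) ≠ s(j, k) := by simp [hjk, hij, hik]
    have hpair : ∀ (l : Fin (r + 1)) (e e' : Sym2 (Fin (r + 1))), l ∈ e → l ∈ e' →
        e ∈ (⊤ : SimpleGraph (Fin (r + 1))).edgeSet →
        e' ∈ (⊤ : SimpleGraph (Fin (r + 1))).edgeSet → e ≠ e' →
        v (φ e) ∉ Submodule.span K {v (φ e')} := by
      intro l e e' hl hl' he he' hne hcon
      have hF : ({e, e'} : Set (Sym2 (Fin (r + 1)))) ⊆ (⊤ : SimpleGraph (Fin (r + 1))).edgeSet := by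
        rintro x (rfl | rfl) <;> assumption
      have hind := (h _ hF).2 (hstarA l _ (by rintro x (rfl | rfl) <;> assumption))
      rw [image_pair] at hind
      have hnot : φ e ∉ ({φ e'} : Set E) := fun hh => hne (hφ he he' hh)
      have := ((linearIndepOn_insert hnot).1 hind).2
      rw [image_singleton] at this
      exact this hcon
    have hdep : v (φ s(i, j)) ∈ Submodule.span K {v (φ s(i, k)), v (φ s(j, k))} := by
      by_contra hcon
      have hF2 : ({s(i, k), s(j, k)} : Set (Sym2 (Fin (r + 1)))) ⊆
          (⊤ : SimpleGraph (Fin (r + 1))).edgeSet := by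
        rintro x (rfl | rfl)
        · exact hmem hik
        · exact hmem hjk
      have hind := (h _ hF2).2 (hstarA k _ (by rintro x (rfl | rfl) <;> simp))
      have hnot : φ s(i, j) ∉ φ '' {s(i, k), s(j, k)} := by
        rintro ⟨e, he, heq⟩
        have := hφ (hF2 he) (hmem hij) heq
        rcases he with rfl | rfl
        · exact e1 this.symm
        · exact e2 this.symm
      have h3 : LinearIndepOn K v (φ '' insert s(i, j) {s(i, k), s(j, k)}) := by
        rw [image_insert_eq, linearIndepOn_insert hnot]
        refine ⟨hind, ?_⟩
        rwa [image_pair, image_pair]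
      have h4 := (h _ (insert_subset (hmem hij) hF2)).1 h3
      rw [SimpleGraph.fromEdgeSet_insert_eq, SimpleGraph.isAcyclic_sup_fromEdgeSet_iff] at h4
      have hreach : (SimpleGraph.fromEdgeSet
          ({s(i, k), s(j, k)} : Set (Sym2 (Fin (r + 1))))).Reachable i j := by
        have a1 : (SimpleGraph.fromEdgeSet
            ({s(i, k), s(j, k)} : Set (Sym2 (Fin (r + 1))))).Adj i k := by
          rw [SimpleGraph.fromEdgeSet_adj]
          exact ⟨Or.inl rfl, hik⟩
        have a2 : (SimpleGraph.fromEdgeSet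
            ({s(i, k), s(j, k)} : Set (Sym2 (Fin (r + 1))))).Adj j k := by
          rw [SimpleGraph.fromEdgeSet_adj]
          exact ⟨Or.inr rfl, hjk⟩
        exact a1.reachable.trans a2.reachable.symm
      rcases h4.2 hreach with h5 | h5
      · exact hij h5
      · rcases ((SimpleGraph.fromEdgeSet_adj _).1 h5).1 with h6 | h6
        · exact e1 h6
        · exact e2 h6
    obtain ⟨α, β, hαβ⟩ := Submodule.mem_span_pair.1 hdep
    refine ⟨α, β, ?_, ?_, hαβ.symm⟩
    · rintro rfl
      rw [zero_smul, zero_add] at hαβ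
      exact hpair j _ _ (by simp) (by simp) (hmem hij) (hmem hjk) e2
        (Submodule.mem_span_singleton.2 ⟨β, hαβ⟩)
    · rintro rfl
      rw [zero_smul, add_zero] at hαβ
      exact hpair i _ _ (by simp) (by simp) (hmem hij) (hmem hik) e1
        (Submodule.mem_span_singleton.2 ⟨α, hαβ⟩)

/-! ### The numerical bound -/

lemma modularBound_mono {Δ n n' : ℕ} (h : n ≤ n') : modularBound Δ n ≤ modularBound Δ n' := by
  unfold modularBound
  gcongr

lemma add_two_pow_four_le (k : ℕ) : (k + 2) ^ 4 ≤ 81 * 2 ^ k := by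
  rcases Nat.lt_or_ge k 4 with hk | hk
  · interval_cases k <;> norm_num
  · induction k, hk using Nat.le_induction with
    | base => norm_num
    | succ k hk ih =>
      obtain ⟨j, rfl⟩ := Nat.exists_eq_add_of_le hk
      have : (4 + j + 1 + 2) ^ 4 ≤ 2 * (4 + j + 2) ^ 4 := by
        ring_nf
        nlinarith [sq_nonneg j, Nat.zero_le (j ^ 3), Nat.zero_le (j ^ 4), Nat.zero_le (j ^ 2)]
      calc (4 + j + 1 + 2) ^ 4 ≤ 2 * (4 + j + 2) ^ 4 := this
        _ ≤ 2 * (81 * 2 ^ (4 + j)) := Nat.mul_le_mul_left 2 ih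
        _ = 81 * 2 ^ (4 + j + 1) := by ring

/-- For large `Δ`, the bound is of order `Δ ^ 5 (log Δ) ^ 4`; here
`(k + 2) ^ 4 ≤ 81 Δ` is enough. -/
lemma modularBound_le_of_twelve_le {Δ k n : ℕ} (hΔ : 12 ≤ Δ) (hk : 2 ^ k ≤ Δ)
    (hn : n ≤ 1 + (2 * k + 4) * (2 * Δ - 2)) : modularBound Δ n ≤ 70 * Δ ^ 7 := by
  obtain ⟨d, rfl⟩ := Nat.exists_eq_add_of_le hΔ
  have hn' : (n : ℝ) ≤ 1 + 4 * (k + 2) * (11 + d) := by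
    have : n ≤ 1 + 4 * (k + 2) * (11 + d) := by
      refine hn.trans (le_of_eq ?_)
      rw [show 2 * (12 + d) - 2 = 2 * (11 + d) by omega]
      ring
    exact_mod_cast this
  have hk4 : ((k : ℝ) + 2) ^ 4 ≤ 81 * (12 + d) := by
    have := (add_two_pow_four_le k).trans (Nat.mul_le_mul_left 81 hk)
    exact_mod_cast this
  -- `n - 1` is at most `88 + x`, with `x = 0` at `k = 0` and `Δ = 12`; the counting polynomial,
  -- with leading terms `n ^ 3 / 2` and `n ^ 4 / 24`, is then below `517 / 10000 * (88 + x) ^ 4`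
  obtain ⟨x, hx0, hx⟩ : ∃ x : ℝ, 0 ≤ x ∧ 4 * ((k : ℝ) + 2) * (11 + d) = 88 + x := by
    refine ⟨4 * ((k : ℝ) + 2) * (11 + d) - 88, ?_, by ring⟩
    have h1 : (0 : ℝ) ≤ k := k.cast_nonneg
    have h2 : (0 : ℝ) ≤ d := d.cast_nonneg
    nlinarith
  rw [add_comm, hx] at hn'
  have hm4 : (88 + x) ^ 4 ≤ 20736 * (12 + d) * (11 + d) ^ 4 := by
    rw [← hx, mul_pow, mul_pow]
    have : (0 : ℝ) ≤ (11 + d) ^ 4 := by positivity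
    nlinarith
  have c2 := Nat.choose_le_pow_div (α := ℝ) 2 n
  have c3 := Nat.choose_le_pow_div (α := ℝ) 3 n
  have c4 := Nat.choose_le_pow_div (α := ℝ) 4 n
  simp only [Nat.factorial] at c2 c3 c4
  norm_num at c2 c3 c4
  have hn0 : (0 : ℝ) ≤ n := n.cast_nonneg
  have hS : (n : ℝ) * (1 + n + n.choose 2) + (1 + n + n.choose 2 + n.choose 3 + n.choose 4)
      ≤ 517 / 10000 * (88 + x) ^ 4 := by
    calc (n : ℝ) * (1 + n + n.choose 2) + (1 + n + n.choose 2 + n.choose 3 + n.choose 4)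
        ≤ n * (1 + n + n ^ 2 / 2) + (1 + n + n ^ 2 / 2 + n ^ 3 / 6 + n ^ 4 / 24) := by gcongr
      _ ≤ (88 + x + 1) * (1 + (88 + x + 1) + (88 + x + 1) ^ 2 / 2) + (1 + (88 + x + 1)
          + (88 + x + 1) ^ 2 / 2 + (88 + x + 1) ^ 3 / 6 + (88 + x + 1) ^ 4 / 24) := by gcongr
      _ ≤ 517 / 10000 * (88 + x) ^ 4 := by
        rw [← sub_nonneg]
        ring_nf
        positivity
  have hfin : 517 / 10000 * (20736 * (12 + d) * (11 + d) ^ 4) ≤ (70 * (12 + d) ^ 6 : ℝ) := by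
    have : (0 : ℝ) ≤ 70 * (12 + d) ^ 5 - 517 / 10000 * 20736 * (11 + d) ^ 4 := by
      ring_nf
      positivity
    have h2 := mul_nonneg (show (0 : ℝ) ≤ 12 + d by positivity) this
    linarith
  have hR : ((modularBound (12 + d) n : ℕ) : ℝ) ≤ ((70 * (12 + d) ^ 7 : ℕ) : ℝ) := by
    simp only [modularBound, Finset.sum_range_succ, Finset.sum_range_zero, Nat.choose_zero_right,
      Nat.choose_one_right, zero_add]
    push_cast
    calc ((12 : ℝ) + d) * (n * (1 + n + n.choose 2)
          + (1 + n + n.choose 2 + n.choose 3 + n.choose 4))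
        ≤ (12 + d) * (70 * (12 + d) ^ 6) := by
          gcongr
          linarith
      _ = 70 * (12 + d) ^ 7 := by ring
  exact_mod_cast hR

/-- The numerical estimate behind the constant `70`, for `q = p - 1` with a prime `p` above `Δ`. The
cases `Δ < 12` are computed; for `Δ = 4` the prime `2 Δ - 1 = 7` allowed by Bertrand's postulate
would be too large, and `5` is used. -/
lemma modularBound_le {Δ k q n : ℕ} (hΔ : 2 ≤ Δ) (hk : 2 ^ k ≤ Δ) (hq : q ≤ 2 * Δ - 2)
    (hq4 : Δ = 4 → q = 4) (hn : n ≤ 1 + (2 * k + 4) * q) : modularBound Δ n ≤ 70 * Δ ^ 7 := by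
  rcases Nat.lt_or_ge Δ 12 with hlt | hge
  · have hk3 : k ≤ 3 := by
      by_contra! h
      have := Nat.pow_le_pow_right (show 0 < 2 by norm_num) h
      omega
    by_cases h4 : Δ = 4
    · have hq' := hq4 h4
      subst h4 hq'
      have hk2 : k ≤ 2 := by
        by_contra! h
        have := Nat.pow_le_pow_right (show 0 < 2 by norm_num) h
        omega
      refine (modularBound_mono (n' := 33) (by omega)).trans ?_
      simp [modularBound, Finset.sum_range_succ,
          Nat.choose_eq_descFactorial_div_factorial, Nat.descFactorial_succ, Nat.factorial]
    · have hn' : n ≤ 1 + (2 * k + 4) * (2 * Δ - 2) :=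
        hn.trans (by gcongr)
      refine (modularBound_mono hn').trans ?_
      interval_cases Δ <;> interval_cases k <;> first
        | omega
        | simp [modularBound, Finset.sum_range_succ,
          Nat.choose_eq_descFactorial_div_factorial, Nat.descFactorial_succ, Nat.factorial]
  · exact modularBound_le_of_twelve_le hge hk (hn.trans (by gcongr))

/-- Bertrand's postulate, with better choices for `Δ = 1` and `Δ = 4`. -/
lemma exists_prime_near {Δ : ℕ} (hΔ : 0 < Δ) : ∃ p, p.Prime ∧ Δ < p ∧ (Δ = 1 → p = 2) ∧
    (2 ≤ Δ → p - 1 ≤ 2 * Δ - 2) ∧ (Δ = 4 → p - 1 = 4) := by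
  by_cases h4 : Δ = 4
  · subst h4
    exact ⟨5, by norm_num, by norm_num, by norm_num, by norm_num, by norm_num⟩
  obtain ⟨p, hp, hlt, hle⟩ := Nat.exists_prime_lt_and_le_two_mul Δ hΔ.ne'
  refine ⟨p, hp, hlt, fun h => by omega, fun h => ?_, fun h => absurd h h4⟩
  have : p ≠ 2 * Δ := by
    rintro rfl
    rcases (Nat.dvd_prime hp).1 (Dvd.intro Δ rfl) with h' | h' <;> omega
  omega

/-! ### Long lines -/

namespace Matroid

variable {α : Type*} {M : Matroid α}

lemma IsSimpleMatroid.indep_pair (hM : M.IsSimpleMatroid) {x y : α} (hx : x ∈ M.E) (hy : y ∈ M.E) :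
    M.Indep {x, y} := by
  by_contra hcon
  obtain ⟨C, hC, hCc⟩ := ((not_indep_iff (pair_subset hx hy)).1 hcon).exists_isCircuit_subset
  have h1 : C.encard ≤ 2 := (encard_le_encard hC).trans ((encard_insert_le _ _).trans (by
    rw [encard_singleton]; norm_num))
  have h2 := hM C hCc
  have h0 : C.encard ≠ 0 := by
    rw [Ne, encard_eq_zero]
    exact hCc.nonempty.ne_empty
  generalize C.encard = n at *
  enat_to_nat
  omega

/-- The points of a simple matroid are single elements. -/
lemma IsSimpleMatroid.exists_eq_singleton (hM : M.IsSimpleMatroid) {P : Set α}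
    (hP : M.IsPoint P) : ∃ x, P = {x} := by
  have hne : P.Nonempty := by
    rw [nonempty_iff_ne_empty]
    rintro rfl
    simpa using hP.prop.2
  obtain ⟨x, hx⟩ := hne
  refine ⟨x, Subset.antisymm (fun y hy => ?_) (by simpa using hx)⟩
  by_contra hyx
  have h1 := (hM.indep_pair (hP.prop.1 hx) (hP.prop.1 hy)).encard_le_eRk_of_subset
    (pair_subset hx hy)
  rw [hP.prop.2, encard_pair (Ne.symm hyx)] at h1
  exact absurd h1 (by norm_num)

lemma IsSimpleMatroid.eq_closure_pair (hM : M.IsSimpleMatroid) {L : Set α} (hL : M.IsLine L)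
    {f g : α} (hf : f ∈ L) (hg : g ∈ L) (hfg : f ≠ g) : L = M.closure {f, g} := by
  have hind := hM.indep_pair (hL.prop.1 hf) (hL.prop.1 hg)
  have hrk : M.eRk {f, g} = 2 := by rw [hind.eRk_eq_encard, encard_pair hfg]
  have hsub : L ⊆ M.closure {f, g} := by
    intro x hx
    by_contra hcon
    have hx' : x ∉ ({f, g} : Set α) := fun h => hcon (M.mem_closure_of_mem h hind.subset_ground)
    have h3 := ((hind.notMem_closure_iff (hL.prop.1 hx)).1 hcon).1.encard_le_eRk_of_subset
      (insert_subset hx (pair_subset hf hg))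
    rw [hL.prop.2, encard_insert_of_notMem hx', encard_pair hfg] at h3
    exact absurd h3 (by norm_num)
  exact Subset.antisymm hsub (hL.le_of_ge ⟨M.closure_subset_ground _, by rw [eRk_closure_eq, hrk]⟩
    hsub)

lemma IsSimpleMatroid.exists_pair_of_isLongLine (hM : M.IsSimpleMatroid) {L : Set α}
    (hL : M.IsLongLine L) {f : α} (hf : f ∈ L) :
    ∃ g ∈ L, ∃ h ∈ L, g ≠ f ∧ h ≠ f ∧ g ≠ h := by
  have h3 : 3 ≤ L.encard := by
    refine hL.2.trans ((encard_le_encard (t := singleton '' L) ?_).trans (encard_image_le _ _))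
    rintro P ⟨hP, hPL⟩
    obtain ⟨x, rfl⟩ := hM.exists_eq_singleton hP
    exact ⟨x, hPL rfl, rfl⟩
  have h2 : 1 < (L \ {f}).encard := by
    have := encard_sdiff_singleton_add_one hf
    rw [← this] at h3
    generalize (L \ {f}).encard = n at *
    enat_to_nat
    omega
  obtain ⟨g, h, hg, hh, hgh⟩ := one_lt_encard_iff.1 h2
  exact ⟨g, hg.1, h, hh.1, hg.2, hh.2, hgh⟩

end Matroid

/-- The edges at a vertex are independent. -/
lemma CliqueFrame.linearIndepOn_star {K E V : Type*} [Field K] [Fintype V] [DecidableEq V]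
    {u : E → V → K} {edge : V → V → E} (hu : CliqueFrame u edge) (j : V) :
    LinearIndepOn K u {x | ∃ k, k ≠ j ∧ x = edge k j} := by
  have hset : {x | ∃ k, k ≠ j ∧ x = edge k j} = range fun k : {k // k ≠ j} => edge k j := by
    ext x
    simp [eq_comm]
  have hdiag : ∀ k : {k // k ≠ j}, u (edge k j) k ≠ 0 := by
    intro k
    obtain ⟨c, hc, he⟩ := hu.edge_eq k j k.2
    simp [he, hc, k.2]
  have hoff : ∀ k l : {k // k ≠ j}, l ≠ k → u (edge k j) l = 0 := by
    intro k l hlk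
    obtain ⟨c, hc, he⟩ := hu.edge_eq k j k.2
    have : (l : V) ≠ k := fun h => hlk (Subtype.ext h)
    simp [he, l.2, this]
  rw [hset, linearIndepOn_range_iff]
  · rw [Fintype.linearIndependent_iff]
    intro g hg l
    have h1 := congrFun hg l
    rw [Finset.sum_apply, Finset.sum_eq_single l] at h1
    · exact (mul_eq_zero.1 h1).resolve_right (hdiag l)
    · intro k _ hkl
      simp [hoff k l hkl.symm]
    · simp
  · intro k l hkl
    by_contra hne
    have := hdiag k
    simp only at hkl
    rw [hkl, hoff l k hne] at this
    exact this rfl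

namespace Matroid

variable {α : Type*} {M : Matroid α}

/-- If `f` has a nonzero coordinate `j` outside `H`, then each long line through `f` has a further
element that is supported on `H ∪ {j}` or is one of the edges at `j`; the latter are independent, so
their number is at most the rank of the union of the lines. -/
lemma encard_longLinesThrough_le {V : Type*} [Fintype V] [DecidableEq V]
    (hM : M.IsSimpleMatroid) {u : M.E → V → ℝ} {edge : V → V → M.E}
    (hind : ∀ I : Set M.E, M.Indep (Subtype.val '' I) ↔ LinearIndepOn ℝ u I)
    (hu : CliqueFrame u edge) {H : Finset V} (hH : EdgesOutside u H) {f : M.E} {j : V}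
    (hj : j ∉ H) (hfj : u f j ≠ 0) (S : Finset M.E)
    (hS : ∀ x, (∀ v ∉ insert j H, u x v = 0) → x ∈ S) :
    (M.longLinesThrough f).encard ≤ M.eRk (⋃₀ M.longLinesThrough f) + S.card := by
  classical
  let J : Set M.E := {x | ∃ k, k ≠ j ∧ x = edge k j}
  have hpair : ∀ x y : M.E, LinearIndepOn ℝ u {x, y} := fun x y => by
    rw [← hind, image_pair]
    exact hM.indep_pair x.2 y.2
  have hedge : ∀ x : M.E, x ∉ S → u x j ≠ 0 → x ∈ J := by
    intro x hx hxj
    obtain ⟨k, hk, hxk⟩ : ∃ k ∉ insert j H, u x k ≠ 0 := by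
      by_contra! hcon
      exact hx (hS x hcon)
    rw [Finset.mem_insert, not_or] at hk
    obtain ⟨c, hc⟩ := hH x k hk.2 j hj hk.1 hxk hxj
    obtain ⟨c', hc', he⟩ := hu.edge_eq k j hk.1
    refine ⟨k, hk.1, ?_⟩
    by_contra hne
    have h1 := (linearIndepOn_insert (s := {edge k j}) (by simpa using hne)).1 (hpair x (edge k j))
    refine h1.2 ?_
    rw [image_singleton, Submodule.mem_span_singleton]
    exact ⟨c / c', by rw [he, hc, smul_smul, div_mul_cancel₀ _ hc']⟩
  have hline : ∀ L ∈ M.longLinesThrough f, ∃ x : M.E, (x : α) ∈ L ∧ x ≠ f ∧ (x ∈ S ∨ x ∈ J) := by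
    rintro L ⟨hL, hfL⟩
    obtain ⟨g, hg, h, hh, hgf, hhf, hgh⟩ := hM.exists_pair_of_isLongLine hL hfL
    have hLE := hL.1.prop.1
    lift g to M.E using hLE hg
    lift h to M.E using hLE hh
    by_contra! hcon
    have hg' := hcon g hg fun e => hgf (e ▸ rfl)
    have hh' := hcon h hh fun e => hhf (e ▸ rfl)
    have hgj : u g j = 0 := by
      by_contra h0
      exact hg'.2 (hedge g hg'.1 h0)
    have hhj : u h j = 0 := by
      by_contra h0
      exact hh'.2 (hedge h hh'.1 h0)
    -- otherwise `f`, spanned by two elements that vanish at `j`, would vanish at `j`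
    have hspan : u f ∈ Submodule.span ℝ {u g, u h} := by
      by_contra hnot
      have hfn : f ∉ ({g, h} : Set M.E) := by
        rintro (e | e)
        · exact hgf (e ▸ rfl)
        · exact hhf (Subtype.ext_iff.1 e).symm
      have h1 : LinearIndepOn ℝ u (insert f {g, h}) := by
        rw [linearIndepOn_insert hfn, image_pair]
        exact ⟨hpair g h, hnot⟩
      have h2 := ((hind _).2 h1).encard_le_eRk_of_subset (X := L) (by
        rintro _ ⟨x, rfl | rfl | rfl, rfl⟩ <;> assumption)
      rw [hL.1.prop.2, Subtype.val_injective.encard_image, encard_insert_of_notMem hfn,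
        encard_pair fun e => hgh (congrArg _ e)] at h2
      exact absurd h2 (by norm_num)
    obtain ⟨s, t, hst⟩ := Submodule.mem_span_pair.1 hspan
    apply hfj
    rw [← hst]
    simp [hgj, hhj]
  have : Nonempty M.E := ⟨f⟩
  choose! χ hχL hχf hχ using hline
  -- a line is the closure of `f` and any other of its elements
  have hinj : InjOn χ (M.longLinesThrough f) := by
    intro L hL L' hL' heq
    rw [hM.eq_closure_pair hL.1.1 hL.2 (hχL L hL) fun e => hχf L hL (Subtype.ext e.symm), heq,
      ← hM.eq_closure_pair hL'.1.1 hL'.2 (hχL L' hL') fun e => hχf L' hL' (Subtype.ext e.symm)]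
  let J' : Set M.E := J ∩ {x | (x : α) ∈ ⋃₀ M.longLinesThrough f}
  have himg : χ '' M.longLinesThrough f ⊆ J' ∪ S := by
    rintro _ ⟨L, hL, rfl⟩
    rcases hχ L hL with h | h
    · exact Or.inr h
    · exact Or.inl ⟨h, L, hL, hχL L hL⟩
  have hJ' : J'.encard ≤ M.eRk (⋃₀ M.longLinesThrough f) := by
    rw [← Subtype.val_injective.encard_image]
    refine ((hind J').2 ((hu.linearIndepOn_star j).mono inter_subset_left)).encard_le_eRk_of_subset
      ?_
    rintro _ ⟨x, hx, rfl⟩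
    exact hx.2
  calc (M.longLinesThrough f).encard = (χ '' M.longLinesThrough f).encard :=
        hinj.encard_image.symm
    _ ≤ (J' ∪ S).encard := encard_le_encard himg
    _ ≤ J'.encard + (S : Set M.E).encard := encard_union_le _ _
    _ ≤ _ := by
      rw [encard_coe_eq_coe_finsetCard]
      gcongr

end Matroid

/-! ### Bounding the critical elements -/

/-- The determinant of the change of coordinates is the common factor of the determinants. -/
lemma integralFrame_of_cliqueFrame {E : Type*} {r : ℕ} {a : E → Fin r → ℤ}
    {edge : Fin (r + 1) → Fin (r + 1) → E} (Φ : (Fin r → ℝ) ≃ₗ[ℝ] (Fin r → ℝ))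
    (h : CliqueFrame (fun x => rootExtend (Φ fun i => (a x i : ℝ))) edge) :
    IntegralFrame (fun x => rootExtend (Φ fun i => (a x i : ℝ))) edge a := by
  refine ⟨h, ⟨rootExtendLin ℝ r ∘ₗ Φ.toLinearMap, fun x => rfl⟩,
    LinearMap.det Φ.toLinearMap, (LinearEquiv.isUnit_det' Φ).ne_zero, fun c => ?_⟩
  have h1 : (Matrix.of fun t i => rootExtend (Φ fun i => (a (c t) i : ℝ)) (Fin.succ i))
      = (LinearMap.toMatrix' Φ.toLinearMap *
          (Matrix.of fun t i => (a (c t) i : ℝ)).transpose).transpose := by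
    ext t i
    rw [Matrix.transpose_apply, Matrix.mul_apply_eq_vecMul]
    have h2 : Φ.toLinearMap (fun i => (a (c t) i : ℝ)) i = _ :=
      congrFun (LinearMap.toMatrix'_mulVec Φ.toLinearMap _).symm i
    simpa [rootExtend, Matrix.mulVec, Matrix.vecMul, dotProduct, mul_comm] using h2
  rw [h1, Matrix.det_transpose, Matrix.det_mul, Matrix.det_transpose, LinearMap.det_toMatrix']
  congr 1
  exact (Int.cast_det _).symm

lemma linearIndepOn_rootExtend_iff {K E : Type*} [Field K] {r : ℕ} (v : E → Fin r → K)
    (Φ : (Fin r → K) ≃ₗ[K] (Fin r → K)) (I : Set E) :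
    LinearIndepOn K (fun x => rootExtend (Φ (v x))) I ↔ LinearIndepOn K v I := by
  let f : (Fin r → K) →ₗ[K] (Fin (r + 1) → K) := rootExtendLin K r ∘ₗ Φ.toLinearMap
  have hf : LinearMap.ker f = ⊥ := by
    rw [LinearMap.ker_eq_bot]
    have h1 : Function.Injective (rootExtendLin K r) := fun g h hgh => funext fun i => by
      simpa [rootExtendLin_apply, rootExtend] using congrFun hgh i.succ
    exact h1.comp Φ.injective
  exact f.linearIndependent_iff hf

theorem proposition3p2 {α : Type*} (r Δ : ℕ) (hr : 0 < r) (hΔ : 0 < Δ)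
    (M : Matroid α) [M.Finite] (hmod : M.IsModularMatroid Δ) (hsimple : M.IsSimpleMatroid)
    (hrank : M.eRank = (r : ℕ∞)) (hclique : M.HasRestriction (Matroid.clique (r + 1))) :
    {f | M.IsCritical Δ f}.encard ≤ 200 * (Δ : ℕ∞) ^ 7 := by
  classical
  have : Fintype M.E := M.ground_finite.fintype
  obtain ⟨a, ha, hindep⟩ := hmod.exists_vectors hrank
  obtain ⟨φ, hφ, hforest⟩ := hclique.exists_clique_map hr
  obtain ⟨p, hp, hΔp, hp1, hp2, hp4⟩ := exists_prime_near hΔ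
  have : Fact p.Prime := ⟨hp⟩
  obtain ⟨Φ, hΦ⟩ := exists_cliqueFrame_of_acyclic (fun x i => (a x i : ℝ)) φ hφ fun F hF =>
    (hindep _).symm.trans (hforest F hF)
  have hint := integralFrame_of_cliqueFrame Φ hΦ
  set u : M.E → Fin (r + 1) → ℝ := fun x => rootExtend (Φ fun i => (a x i : ℝ)) with hu
  have hmodp := linearIndepOn_real_iff_modp a ha hΔp ⟨_, hint.det_star_ne_zero⟩
  obtain ⟨Ψ, hΨ⟩ := exists_cliqueFrame_of_acyclic (fun x i => (a x i : ZMod p)) φ hφ fun F hF =>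
    (hmodp _).symm.trans ((hindep _).symm.trans (hforest F hF))
  have hui : ∀ I : Set M.E, M.Indep (Subtype.val '' I) ↔ LinearIndepOn ℝ u I := fun I =>
    (hindep I).trans (linearIndepOn_rootExtend_iff _ Φ I).symm
  have hpair : CliquePair p u (fun x => rootExtend (Ψ fun i => (a x i : ZMod p)))
      fun i j => φ s(i, j) :=
    ⟨hΦ, hΨ, fun I => (hui I).symm.trans ((hindep I).trans ((hmodp I).trans
      (linearIndepOn_rootExtend_iff _ Ψ I).symm))⟩
  -- simplicity excludes equal and opposite vectors
  have hpar : ∀ x y, (a x = a y ∨ a x = -a y) → x = y := by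
    intro x y hxy
    by_contra hne
    have h1 : M.Indep (Subtype.val '' {x, y}) := by
      rw [image_pair]
      exact hsimple.indep_pair x.2 y.2
    rw [hindep, linearIndepOn_insert (by simpa using hne), image_singleton] at h1
    refine h1.2 (Submodule.mem_span_singleton.2 ?_)
    rcases hxy with h | h
    · exact ⟨1, by simp [h]⟩
    · exact ⟨-1, by ext i; simp [h]⟩
  obtain ⟨H, h0, hH, hN⟩ : ∃ H : Finset (Fin (r + 1)), 0 ∈ H ∧ EdgesOutside u H ∧
      modularBound Δ H.card ≤ 70 * Δ ^ 7 := by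
    rcases (show Δ = 1 ∨ 2 ≤ Δ by omega) with h1 | h1
    · -- with `p = 2` all supports have at most two elements, and the root alone will do
      have hp' := hp1 h1
      refine ⟨{0}, by simp, hΦ.edgesOutside_of_card_support_le fun f => ?_, ?_⟩
      · have := hpair.card_support_le f
        omega
      · subst h1
        simp [modularBound, Finset.sum_range_succ, Nat.choose]
    · obtain ⟨H₀, k, h0, hk, hcard, hcancel⟩ := hint.exists_hub ha hpair.card_support_le
      obtain ⟨H, hsub, hcard', hH⟩ := hpair.exists_edgesOutside H₀ hcancel
      refine ⟨H, hsub h0, hH, modularBound_le h1 hk (hp2 h1) hp4 (hcard'.trans ?_)⟩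
      calc H₀.card + 4 * (p - 1) ≤ 1 + k * (2 * (p - 1)) + 4 * (p - 1) := by gcongr
        _ = 1 + (2 * k + 4) * (p - 1) := by ring
  let S (Y : Finset (Fin (r + 1))) : Finset M.E :=
    Finset.univ.filter fun x => ∀ v ∉ Y, u x v = 0
  have hS : ∀ Y, 0 ∈ Y → (S Y).card ≤ modularBound Δ (Y.card - 1) := fun Y hY =>
    hint.card_supported_le ha hpar Y hY _ fun x => by simp [S]
  -- the critical elements are supported on `H`
  have hcrit : {f | M.IsCritical Δ f} ⊆ Subtype.val '' (S H : Set M.E) := by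
    rintro f ⟨hf, hlt⟩
    lift f to M.E using hf
    refine ⟨f, ?_, rfl⟩
    by_contra hnot
    obtain ⟨j, hj, hfj⟩ : ∃ j ∉ H, u f j ≠ 0 := by
      simpa [S] using hnot
    refine absurd hlt (not_lt.2 ?_)
    refine (Matroid.encard_longLinesThrough_le hsimple hui hΦ hH hj hfj (S (insert j H))
      fun x hx => by simpa [S] using hx).trans ?_
    gcongr
    have h1 := hS (insert j H) (Finset.mem_insert_of_mem h0)
    rw [Finset.card_insert_of_notMem hj, Nat.add_sub_cancel] at h1
    exact_mod_cast h1.trans hN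
  have h70 : (S H).card ≤ 200 * Δ ^ 7 := by
    have h1 := (hS H h0).trans ((modularBound_mono (Nat.sub_le _ 1)).trans hN)
    omega
  calc {f | M.IsCritical Δ f}.encard ≤ (Subtype.val '' (S H : Set M.E)).encard :=
        encard_le_encard hcrit
    _ ≤ (S H : Set M.E).encard := encard_image_le _ _
    _ ≤ 200 * (Δ : ℕ∞) ^ 7 := by
      rw [encard_coe_eq_coe_finsetCard]
      exact_mod_cast h70
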